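/- Let $d\ge 1$ be odd, $N\in\mathbb N$, let $\Omega$ be a compact Hausdorff space with an action $T$ of $\mathbb Z^d$ by homeomorphisms, $\mathbf P$ a $T$-invariant and ergodic Borel probability measure on $\Omega$, and $\wedge:\mathbb Z^d\times\mathbb Z^d\to\mathbb R$ an antisymmetric bilinear form. Let $\mathcal A_0=C_c(\Omega\times\mathbb Z^d,M_N(\mathbb C))$ be the $*$-algebra with pointwise linear structure and $$(fg)(\omega,x)=\sum_{y\in\mathbb Z^d}e^{\imath\,x\wedge y}f(\omega,y)\,g(T_y^{-1}\omega,x-y),\qquad f^*(\omega,x)=f(T_x^{-1}\omega,-x)^*,$$ and for $f:\Omega\times\mathbb Z^d\to M_N(\mathbb C)$ and $\omega\in\Omega$ let $\pi_\omega(f)$ be the operator on $\ell^2(\mathbb Z^d,\mathbb C^N)$ given by $$(\pi_\omega(f)\psi)(x)=\sum_{y\in\mathbb Z^d}e^{\imath\,y\wedge x}f(T_x^{-1}\omega,y-x)\,\psi(y),$$ whenever this defines a bounded operator. Let $L^\infty(\mathcal A,\mathbf P)$ be the set of measurable $f$, modulo $\mathbf P$-almost sure equality, such that $\pi_\omega(f)$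 is almost surely bounded with $\|f\|_\infty=\mathbf P\text{-}\mathrm{ess\,sup}_\omega\|\pi_\omega(f)\|<\infty$, and let $\mathcal A_{\rm loc}$ be the set of $f\in L^\infty(\mathcal A,\mathbf P)$ for which there are $A,\lambda>0$ with $\int_\Omega\mathbf P(d\omega)\,\|f(\omega,x)\|\le A\,e^{-\lambda|x|}$ for all $x\in\mathbb Z^d$. Let $\sigma_1,\dots,\sigma_d$ be self-adjoint matrices on $\mathrm{Cliff}(d)=\mathbb C^{d'}$, $d'=2^{(d-1)/2}$, with $\sigma_i\sigma_j+\sigma_j\sigma_i=2\delta_{i,j}$. On $\mathcal H=\ell^2(\mathbb Z^d,\mathbb C^N)\otimes\mathrm{Cliff}(d)$, for $x_0\in\mathbb R^d$, let $D_{x_0}=\sum_{j=1}^d(X_j+x_{0,j})\otimes\sigma_j$, where $X_j$ are the components of the position operator, and where, if $x_0\in\mathbb Z^d$, the action of $D_{x_0}$ on the fiber over the site $x=-x_0$ is replaced by the identity; let $F_{x_0}=D_{x_0}/|D_{x_0}|$. An odd Fredholm module $(\mathcal H,F,\pi)$ over a $*$-algebra consists of a $*$-representation $\pi$ on $\mathcal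 H$ and an operator $F$ with $F^*=F$, $F^2=\mathbf 1$ and $[F,\pi(a)]$ compact for all $a$; it is $p$-summable if $\mathrm{Tr}(|[F,\pi(a)]|^p)<\infty$ for all $a$. Then: (i) For all $\omega\in\Omega$ and all $x_0\in[0,1]^d$, $(\mathcal H,F_{x_0},\pi_\omega\otimes\mathrm{id})$ is a $(d+1)$-summable odd Fredholm module over $\mathcal A_0$. (ii) These Fredholm modules extend almost surely to $\mathcal A_{\rm loc}$. That is: $\mathcal A_{\rm loc}$ contains $\mathcal A_0$ and is closed under the above $*$-algebra operations; up to a null set of $\omega$ the operator $\pi_\omega(f)$ depends only on the class of $f\in\mathcal A_{\rm loc}$; and for every countable set $S\subset\mathcal A_{\rm loc}$ it holds for $\mathbf P$-almost every $\omega$ that, for all $x_0\in[0,1]^d$, the operators $\pi_\omega(f)$, $f\in S$, are bounded, $\pi_\omega$ is unital and respects sums, scalar multiples, products and adjoints of elements of $S$, $F_{x_0}^*=F_{x_0}$, $F_{x_0}^2=\mathbf 1$, and for all $f\in S$ the commutator $[F_{x_0},\pi_\omega(f)\otimes\mathrm{id}]$ is compact and lies in the $(d+1)$-th Schatten class. (iii)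 For every $f\in\mathcal A_{\rm loc}$, $$\int_\Omega\mathbf P(d\omega)\int_{[0,1]^d}dx_0\;\mathrm{Tr}\bigl(|[F_{x_0},\pi_\omega(f)\otimes\mathrm{id}]|^{d+1}\bigr)<\infty .$$ -/

import Mathlib

noncomputable section

namespace OddChern

open MeasureTheory
open scoped MatrixOrder ENNReal lp CompactlySupported

/-- The lattice `ℤ^d`. -/
abbrev Lat (d : ℕ) : Type := Fin d → ℤ

/-- An antisymmetric (real valued) bilinear form `∧` on `ℤ^d`. -/
structure MagneticForm (d : ℕ) where
  form : Lat d →+ Lat d →+ ℝ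
  antisymm : ∀ x y, form x y = -form y x

/-- The phase `e^{i x ∧ y}`. -/
def MagneticForm.phase {d : ℕ} (B : MagneticForm d) (x y : Lat d) : ℂ :=
  Complex.exp (Complex.I * (B.form x y : ℂ))

/-- `N × N` complex matrices. -/
abbrev Mat (N : ℕ) : Type := Matrix (Fin N) (Fin N) ℂ

/-- Matrix valued functions `f(ω, x)` on `Ω × ℤ^d`. -/
abbrev Obs (Ω : Type*) (d N : ℕ) : Type _ := Ω → Lat d → Mat N

section Operations

variable {Ω : Type*} {d N : ℕ} [AddAction (Lat d) Ω]

/-- Twisted convolution `(fg)(ω,x) = ∑_y e^{i x∧y} f(ω,y) g(T_y⁻¹ω, x-y)`. -/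
def conv (B : MagneticForm d) (f g : Obs Ω d N) : Obs Ω d N :=
  fun ω x => ∑' y : Lat d, B.phase x y • (f ω y * g (-y +ᵥ ω) (x - y))

/-- The involution `f^*(ω,x) = f(T_x⁻¹ω,-x)^*`. -/
def invol (f : Obs Ω d N) : Obs Ω d N :=
  fun ω x => (f (-x +ᵥ ω) (-x)).conjTranspose

/-- The unit `1(ω,x) = δ_{x,0}`. -/
def unitObs : Obs Ω d N := fun _ x => if x = 0 then 1 else 0

end Operations

/-! ### The algebra of compactly supported observables -/

/-- The vector space `C_c(Ω × ℤ^d, M_N)`; the form `B` enters through the product. -/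
def CompactObs (Ω : Type*) [TopologicalSpace Ω] {d : ℕ} (_B : MagneticForm d) (N : ℕ) : Type _ :=
  C_c(Ω × Lat d, Mat N)

namespace CompactObs

set_option linter.unusedSectionVars false

variable {Ω : Type*} [TopologicalSpace Ω] {d : ℕ} {B : MagneticForm d} {N : ℕ}

instance : AddCommGroup (CompactObs Ω B N) :=
  inferInstanceAs (AddCommGroup C_c(Ω × Lat d, Mat N))

instance : Module ℂ (CompactObs Ω B N) :=
  inferInstanceAs (Module ℂ C_c(Ω × Lat d, Mat N))

/-- The underlying function on `Ω × ℤ^d`. -/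
def val (f : CompactObs Ω B N) : Obs Ω d N :=
  fun ω x => (show C_c(Ω × Lat d, Mat N) from f) (ω, x)

theorem ext_val {f g : CompactObs Ω B N} (h : ∀ ω x, f.val ω x = g.val ω x) : f = g :=
  CompactlySupportedContinuousMap.ext fun p => h p.1 p.2

theorem continuous_val (f : CompactObs Ω B N) (x : Lat d) : Continuous fun ω => f.val ω x :=
  (CompactlySupportedContinuousMap.toContinuousMap f).continuous.comp (by fun_prop)

theorem exists_finset (f : CompactObs Ω B N) :
    ∃ s : Finset (Lat d), ∀ x, x ∉ s → ∀ ω, f.val ω x = 0 := by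
  have hc : IsCompact (tsupport f.toFun) := f.hasCompactSupport'
  have hf := (hc.image continuous_snd).finite_of_discrete
  refine ⟨hf.toFinset, fun x hx ω => ?_⟩
  by_contra hne
  exact hx (hf.mem_toFinset.2 ⟨(ω, x), subset_tsupport _ hne, rfl⟩)

section Mk

variable [CompactSpace Ω]

/-- A finite range function that is continuous in `ω` is an element of `C_c(Ω × ℤ^d, M_N)`. -/
def mk' (f : Obs Ω d N) (hc : ∀ x, Continuous fun ω => f ω x)
    (hs : ∃ s : Finset (Lat d), ∀ x, x ∉ s → ∀ ω, f ω x = 0) : CompactObs Ω B N :=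
  { toFun := fun p => f p.1 p.2
    continuous_toFun := continuous_prod_of_discrete_right.2 hc
    hasCompactSupport' := by
      obtain ⟨s, hs⟩ := hs
      have hK : IsCompact (Set.univ ×ˢ (s : Set (Lat d)) : Set (Ω × Lat d)) :=
        isCompact_univ.prod s.finite_toSet.isCompact
      refine HasCompactSupport.intro' hK
        (isClosed_univ.prod (isClosed_discrete (s : Set (Lat d)))) ?_
      rintro ⟨ω, x⟩ hx
      exact hs x (fun h => hx ⟨trivial, h⟩) ω }

@[simp] theorem val_mk' (f : Obs Ω d N) (hc hs) : (mk' f hc hs : CompactObs Ω B N).val = f := rfl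

end Mk

@[simp] theorem val_add (f g : CompactObs Ω B N) : (f + g).val = f.val + g.val := rfl
@[simp] theorem val_zero : (0 : CompactObs Ω B N).val = 0 := rfl
@[simp] theorem val_smul (c : ℂ) (f : CompactObs Ω B N) : (c • f).val = c • f.val := rfl

variable [AddAction (Lat d) Ω]

theorem conv_eq_sum (f g : Obs Ω d N) (s : Finset (Lat d)) (hs : ∀ x, x ∉ s → ∀ ω, f ω x = 0)
    (ω : Ω) (x : Lat d) :
    conv B f g ω x = ∑ y ∈ s, B.phase x y • (f ω y * g (-y +ᵥ ω) (x - y)) :=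
  tsum_eq_sum fun y hy => by rw [hs y hy ω, zero_mul, smul_zero]

theorem conv_support (f g : Obs Ω d N) (s t : Finset (Lat d))
    (hs : ∀ x, x ∉ s → ∀ ω, f ω x = 0) (ht : ∀ x, x ∉ t → ∀ ω, g ω x = 0) :
    ∀ x, x ∉ (s ×ˢ t).image (fun p => p.1 + p.2) → ∀ ω, conv B f g ω x = 0 := by
  intro x hx ω
  rw [conv_eq_sum f g s hs]
  refine Finset.sum_eq_zero fun y hy => ?_
  rw [ht (x - y) (fun h => hx (Finset.mem_image.2
    ⟨(y, x - y), Finset.mem_product.2 ⟨hy, h⟩, by simp⟩)), mul_zero, smul_zero]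

theorem phase_self (x : Lat d) : B.phase x x = 1 := by
  have h : B.form x x = 0 := by linarith [B.antisymm x x]
  simp [MagneticForm.phase, h]

theorem phase_zero_right (x : Lat d) : B.phase x 0 = 1 := by
  simp [MagneticForm.phase]

theorem star_phase (x y : Lat d) : star (B.phase x y) = B.phase y x := by
  rw [MagneticForm.phase, MagneticForm.phase, B.antisymm x y, Complex.star_def,
    ← Complex.exp_conj]
  simp

variable [CompactSpace Ω] [ContinuousConstVAdd (Lat d) Ω]

instance : Mul (CompactObs Ω B N) where
  mul f g := mk' (conv B f.val g.val)
    (by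
      obtain ⟨s, hs⟩ := f.exists_finset
      intro x
      simp_rw [conv_eq_sum f.val g.val s hs]
      refine continuous_finsetSum _ fun y _ => ?_
      exact ((f.continuous_val y).mul
        ((g.continuous_val (x - y)).comp (continuous_const_vadd (-y)))).const_smul (B.phase x y))
    (by
      classical
      obtain ⟨s, hs⟩ := f.exists_finset
      obtain ⟨t, ht⟩ := g.exists_finset
      exact ⟨_, conv_support f.val g.val s t hs ht⟩)

instance : One (CompactObs Ω B N) where
  one := mk' unitObs (fun _ => continuous_const)
    ⟨{0}, fun x hx _ => if_neg (by simpa using hx)⟩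

instance : Star (CompactObs Ω B N) where
  star f := mk' (invol f.val)
    (fun x => ((f.continuous_val (-x)).comp (continuous_const_vadd (-x))).matrix_conjTranspose)
    (by
      classical
      obtain ⟨s, hs⟩ := f.exists_finset
      refine ⟨s.image Neg.neg, fun x hx ω => ?_⟩
      have : f.val (-x +ᵥ ω) (-x) = 0 :=
        hs _ (fun h => hx (Finset.mem_image.2 ⟨-x, h, neg_neg x⟩)) _
      simp [invol, this])

@[simp] theorem val_mul (f g : CompactObs Ω B N) : (f * g).val = conv B f.val g.val := rfl
@[simp] theorem val_one : (1 : CompactObs Ω B N).val = unitObs := rfl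
@[simp] theorem val_star (f : CompactObs Ω B N) : (star f).val = invol f.val := rfl

theorem mul_assoc' (f g h : CompactObs Ω B N) : f * g * h = f * (g * h) := by
  classical
  obtain ⟨s, hs⟩ := f.exists_finset
  obtain ⟨t, ht⟩ := g.exists_finset
  obtain ⟨r, hrdef⟩ : ∃ r, r = (s ×ˢ t).image (fun p => p.1 + p.2) := ⟨_, rfl⟩
  have hr : ∀ x, x ∉ r → ∀ ω, (f * g).val ω x = 0 := by
    rw [hrdef]
    exact conv_support f.val g.val s t hs ht
  refine ext_val fun ω x => ?_
  have e1 : (f * g * h).val ω x = ∑ y ∈ r, ∑ z ∈ s,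
      (B.phase x y * B.phase y z) •
        (f.val ω z * g.val (-z +ᵥ ω) (y - z) * h.val (-y +ᵥ ω) (x - y)) := by
    rw [val_mul, conv_eq_sum _ _ r hr]
    refine Finset.sum_congr rfl fun y _ => ?_
    rw [val_mul, conv_eq_sum _ _ s hs, Finset.sum_mul, Finset.smul_sum]
    simp [smul_smul]
  have e2 : (f * (g * h)).val ω x = ∑ z ∈ s, ∑ w ∈ t,
      (B.phase x z * B.phase (x - z) w) •
        (f.val ω z * g.val (-z +ᵥ ω) w * h.val (-(w + z) +ᵥ ω) (x - (w + z))) := by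
    rw [val_mul, conv_eq_sum _ _ s hs]
    refine Finset.sum_congr rfl fun z _ => ?_
    rw [val_mul, conv_eq_sum _ _ t ht, Finset.mul_sum, Finset.smul_sum]
    refine Finset.sum_congr rfl fun w _ => ?_
    rw [vadd_vadd, show -w + -z = -(w + z) by abel, show x - z - w = x - (w + z) by abel]
    simp [smul_smul, mul_assoc]
  rw [e1, e2, Finset.sum_comm]
  refine Finset.sum_congr rfl fun z hz => ?_
  have key : ∀ y, B.phase x z * B.phase (x - z) (y - z) = B.phase x y * B.phase y z := by
    intro y
    simp only [MagneticForm.phase, ← Complex.exp_add]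
    congr 1
    have h0 : B.form z z = 0 := by linarith [B.antisymm z z]
    have h1 := B.antisymm y z
    simp only [map_sub, AddMonoidHom.sub_apply, h0, h1]
    push_cast
    ring
  have hsub : t.image (fun w => w + z) ⊆ r := by
    intro y hy
    obtain ⟨w, hw, rfl⟩ := Finset.mem_image.1 hy
    rw [hrdef]
    exact Finset.mem_image.2 ⟨(z, w), Finset.mem_product.2 ⟨hz, hw⟩, add_comm z w⟩
  rw [← Finset.sum_subset hsub, Finset.sum_image (by intro a _ b _ hab; simpa using hab)]
  · refine Finset.sum_congr rfl fun w _ => ?_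
    have := key (w + z)
    rw [add_sub_cancel_right] at this
    rw [add_sub_cancel_right, this]
  · intro y _ hy
    rw [ht (y - z) (fun h => hy (Finset.mem_image.2 ⟨y - z, h, sub_add_cancel y z⟩)), mul_zero,
      zero_mul, smul_zero]

theorem star_mul' (f g : CompactObs Ω B N) : star (f * g) = star g * star f := by
  refine ext_val fun ω x => ?_
  have e1 : (star (f * g)).val ω x = ∑' y : Lat d,
      (B.phase (-x) y • (f.val (-x +ᵥ ω) y * g.val (-y +ᵥ -x +ᵥ ω) (-x - y))).conjTranspose := by
    change (conv B f.val g.val (-x +ᵥ ω) (-x)).conjTranspose = _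
    rw [conv, Matrix.conjTranspose_tsum]
  rw [e1, val_mul]
  change _ = ∑' y : Lat d, _
  rw [← (Equiv.addRight x).tsum_eq
    (fun y => B.phase x y • ((star g).val ω y * (star f).val (-y +ᵥ ω) (x - y)))]
  refine tsum_congr fun y => ?_
  have hp : star (B.phase (-x) y) = B.phase x (y + x) := by
    rw [star_phase]
    simp only [MagneticForm.phase]
    congr 2
    have h0 : B.form x x = 0 := by linarith [B.antisymm x x]
    rw [map_neg, map_add, h0, B.antisymm y x]
    simp
  rw [Matrix.conjTranspose_smul, Matrix.conjTranspose_mul, hp]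
  simp only [Equiv.coe_addRight, val_star, invol, vadd_vadd]
  rw [show x - (y + x) = -y by abel, show -y + -x = -(y + x) by abel,
    show -x - y = -(y + x) by abel, show - -y + -(y + x) = -x by abel, neg_neg]

instance : Ring (CompactObs Ω B N) :=
  { (inferInstance : AddCommGroup (CompactObs Ω B N)) with
    mul_assoc := mul_assoc'
    one_mul := fun f => ext_val fun ω x => by
      rw [val_mul, val_one,
        conv_eq_sum unitObs _ {0} (fun x hx _ => if_neg (by simpa using hx))]
      simp [unitObs, phase_zero_right]
    mul_one := fun f => ext_val fun ω x => by
      rw [val_mul, conv]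
      rw [tsum_eq_single x (fun y hy => ?_)]
      · simp [unitObs, phase_self]
      · simp [unitObs, sub_eq_zero, hy.symm]
    left_distrib := fun f g h => ext_val fun ω x => by
      obtain ⟨s, hs⟩ := f.exists_finset
      simp [conv_eq_sum _ _ s hs, mul_add, Finset.sum_add_distrib]
    right_distrib := fun f g h => ext_val fun ω x => by
      classical
      obtain ⟨s, hs⟩ := f.exists_finset
      obtain ⟨t, ht⟩ := g.exists_finset
      have h1 : ∀ x, x ∉ s ∪ t → ∀ ω, f.val ω x = 0 := fun x hx =>
        hs x fun h => hx (Finset.mem_union_left _ h)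
      have h2 : ∀ x, x ∉ s ∪ t → ∀ ω, g.val ω x = 0 := fun x hx =>
        ht x fun h => hx (Finset.mem_union_right _ h)
      have h3 : ∀ x, x ∉ s ∪ t → ∀ ω, (f.val + g.val) ω x = 0 := fun x hx ω => by
        simp [h1 x hx ω, h2 x hx ω]
      simp [conv_eq_sum _ _ _ h1, conv_eq_sum _ _ _ h2, conv_eq_sum _ _ _ h3, add_mul,
        Finset.sum_add_distrib]
    zero_mul := fun f => ext_val fun ω x => by simp [conv]
    mul_zero := fun f => ext_val fun ω x => by simp [conv] }

instance : Algebra ℂ (CompactObs Ω B N) :=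
  Algebra.ofModule
    (fun c f g => ext_val fun ω x => by
      obtain ⟨s, hs⟩ := f.exists_finset
      have h1 : ∀ x, x ∉ s → ∀ ω, (c • f.val) ω x = 0 := fun x hx ω => by simp [hs x hx ω]
      simp [conv_eq_sum _ _ _ h1, conv_eq_sum _ _ _ hs, Finset.smul_sum, smul_comm c])
    (fun c f g => ext_val fun ω x => by
      obtain ⟨s, hs⟩ := f.exists_finset
      simp [conv_eq_sum _ _ _ hs, Finset.smul_sum, smul_comm c])

instance : StarRing (CompactObs Ω B N) where
  star_involutive f := ext_val fun ω x => by simp [invol]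
  star_mul := star_mul'
  star_add f g := ext_val fun ω x => by simp [invol]

instance : StarModule ℂ (CompactObs Ω B N) where
  star_smul c f := ext_val fun ω x => by simp [invol]

end CompactObs

/-! ### Operators on `ℓ²` given by kernels -/

/-- The bounded operator `T` on `ℓ²(ι)` is given by the kernel `K`: for all `ψ ∈ ℓ²(ι)`,
`(Tψ)(i) = ∑_j K(i,j) ψ(j)`. -/
def HasKernel {ι : Type*} (T : ℓ²(ι, ℂ) →L[ℂ] ℓ²(ι, ℂ)) (K : ι → ι → ℂ) : Prop :=
  ∀ (ψ : ℓ²(ι, ℂ)) (i : ι), HasSum (fun j => K i j * ψ j) (T ψ i)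

open Classical in
/-- The (unique) bounded operator with kernel `K`; zero if there is none. -/
def kernelOp {ι : Type*} (K : ι → ι → ℂ) : ℓ²(ι, ℂ) →L[ℂ] ℓ²(ι, ℂ) :=
  if h : ∃ T : ℓ²(ι, ℂ) →L[ℂ] ℓ²(ι, ℂ), HasKernel T K then h.choose else 0

/-- Orthonormal basis `|x,n⟩` of `ℓ²(ℤ^d, ℂ^N)`. -/
abbrev Site (d N : ℕ) : Type := Lat d × Fin N

/-- The dimension `d' = 2^{(d-1)/2}` of the spinor space `Cliff(d)` for odd `d`. -/
abbrev spinDim (d : ℕ) : ℕ := 2 ^ ((d - 1) / 2)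

/-- Orthonormal basis `|x,n,j⟩` of `ℋ = ℓ²(ℤ^d, ℂ^N) ⊗ Cliff(d)`. -/
abbrev SpinSite (d N : ℕ) : Type := Lat d × Fin N × Fin (spinDim d)

/-- The Hilbert space `ℋ = ℓ²(ℤ^d, ℂ^N) ⊗ Cliff(d)`. -/
abbrev SpinSpace (d N : ℕ) : Type := ℓ²(SpinSite d N, ℂ)

section Representation

variable {Ω : Type*} {d N : ℕ} [AddAction (Lat d) Ω]

/-- The kernel of `π_ω(f)` on `ℓ²(ℤ^d, ℂ^N)`:
`(π_ω(f)ψ)(x) = ∑_y e^{i y∧x} f(T_x⁻¹ω, y-x) ψ(y)`. -/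
def piKernel (B : MagneticForm d) (ω : Ω) (f : Obs Ω d N) : Site d N → Site d N → ℂ :=
  fun p q => B.phase q.1 p.1 * f (-p.1 +ᵥ ω) (q.1 - p.1) p.2 q.2

/-- The kernel of `π_ω(f) ⊗ id` on `ℋ`. -/
def spinKernel (B : MagneticForm d) (ω : Ω) (f : Obs Ω d N) :
    SpinSite d N → SpinSite d N → ℂ :=
  fun p q => if p.2.2 = q.2.2 then piKernel B ω f (p.1, p.2.1) (q.1, q.2.1) else 0

/-- The operator `π_ω(f) ⊗ id` on `ℋ`. -/
def spinOp (B : MagneticForm d) (ω : Ω) (f : Obs Ω d N) : SpinSpace d N →L[ℂ] SpinSpace d N :=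
  kernelOp (spinKernel B ω f)

end Representation

/-! ### The Dirac phase -/

/-- Self-adjoint generators `σ_1, …, σ_d` of a representation of the complex Clifford algebra on
`ℂ^{d'}`, `d' = 2^{(d-1)/2}` (for odd `d` this dimension forces irreducibility). -/
structure IsCliffordRep {d : ℕ}
    (σ : Fin d → Matrix (Fin (spinDim d)) (Fin (spinDim d)) ℂ) : Prop where
  selfAdjoint : ∀ i, (σ i).conjTranspose = σ i
  anticomm : ∀ i j, σ i * σ j + σ j * σ i = if i = j then 2 else 0

section Dirac

variable {d : ℕ} (σ : Fin d → Matrix (Fin (spinDim d)) (Fin (spinDim d)) ℂ) (x₀ : Fin d → ℝ)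

open Classical in
/-- The action of the shifted Dirac operator `∑_j (X_j + x_{0,j}) ⊗ σ_j` on the spinor fiber over
`x`, with the zero mode at `x = -x₀` replaced by the identity. -/
def diracFiber (x : Lat d) : Matrix (Fin (spinDim d)) (Fin (spinDim d)) ℂ :=
  if ∀ j, (x j : ℝ) + x₀ j = 0 then 1 else ∑ j, (((x j : ℝ) + x₀ j : ℝ) : ℂ) • σ j

/-- The action of `D/|D|` on the spinor fiber over `x`. -/
def phaseFiber (x : Lat d) : Matrix (Fin (spinDim d)) (Fin (spinDim d)) ℂ :=
  diracFiber σ x₀ x * (CFC.abs (diracFiber σ x₀ x))⁻¹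

/-- The kernel of the Dirac phase `F_{x₀} = D_{x₀}/|D_{x₀}|` on `ℋ`. -/
def phaseKernel (N : ℕ) : SpinSite d N → SpinSite d N → ℂ :=
  fun p q => if p.1 = q.1 ∧ p.2.1 = q.2.1 then phaseFiber σ x₀ p.1 p.2.2 q.2.2 else 0

/-- The Dirac phase `F_{x₀}`. -/
def diracPhase (N : ℕ) : SpinSpace d N →L[ℂ] SpinSpace d N :=
  kernelOp (phaseKernel σ x₀ N)

end Dirac

/-! ### Schatten classes and Fredholm modules -/

section Fredholm

variable {H : Type*} [NormedAddCommGroup H] [InnerProductSpace ℂ H] [CompleteSpace H]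

/-- The trace in `[0,∞]` of a positive operator, as the supremum of `∑_k ⟨e_k, A e_k⟩` over the
finite orthonormal families. -/
def posTrace (A : H →L[ℂ] H) : ℝ≥0∞ :=
  ⨆ (s : Finset H) (_ : Orthonormal ℂ (Subtype.val : s → H)),
    ∑ e ∈ s, ENNReal.ofReal (inner ℂ e (A e)).re

/-- `Tr(|T|^p)`. -/
def schattenTrace (p : ℕ) (T : H →L[ℂ] H) : ℝ≥0∞ := posTrace (CFC.abs T ^ p)

/-- `T` belongs to the `p`-th Schatten class. -/
def IsSchatten (p : ℕ) (T : H →L[ℂ] H) : Prop := schattenTrace p T < ∞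

variable (A : Type*) [Ring A] [StarRing A] [Algebra ℂ A] [StarModule ℂ A]

/-- An odd Fredholm module `(H, F, π)` over the unital `*`-algebra `A`. -/
structure OddFredholmModule (H : Type*) [NormedAddCommGroup H] [InnerProductSpace ℂ H]
    [CompleteSpace H] where
  π : A →⋆ₐ[ℂ] (H →L[ℂ] H)
  F : H →L[ℂ] H
  selfAdjoint : ContinuousLinearMap.adjoint F = F
  involutive : F * F = 1
  compact : ∀ a, IsCompactOperator (F * π a - π a * F)

/-- `p`-summability of an odd Fredholm module. -/
def OddFredholmModule.IsSummable {A : Type*} [Ring A] [StarRing A] [Algebra ℂ A] [StarModule ℂ A]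
    (p : ℕ) (M : OddFredholmModule A H) : Prop :=
  ∀ a, IsSchatten p (M.F * M.π a - M.π a * M.F)

end Fredholm

/-! ### Localized observables -/

section Localized

variable {Ω : Type*} {d N : ℕ} [MeasurableSpace Ω] [AddAction (Lat d) Ω]

/-- Equality of observables almost surely, for every `x`. -/
def ObsEq (P : Measure Ω) (f g : Obs Ω d N) : Prop := ∀ x, ∀ᵐ ω ∂P, f ω x = g ω x

/-- Membership in `L^∞(𝒜, P)`: `f` is measurable and the covariant family `π_ω(f)` of operators on
`ℓ²(ℤ^d, ℂ^N)` is almost surely bounded, with `P-esssup ‖π_ω(f)‖ < ∞`. Elements are identified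
along `ObsEq`. -/
structure MemLInfty (B : MagneticForm d) (P : Measure Ω) (f : Obs Ω d N) : Prop where
  measurable : ∀ x n m, AEMeasurable (fun ω => f ω x n m) P
  bounded : ∃ C : ℝ, ∀ᵐ ω ∂P, ∃ T : ℓ²(Site d N, ℂ) →L[ℂ] ℓ²(Site d N, ℂ),
    HasKernel T (piKernel B ω f) ∧ ‖T‖ ≤ C

/-- The Euclidean length of a lattice vector. -/
def latNorm (x : Lat d) : ℝ := Real.sqrt (∑ j, (x j : ℝ) ^ 2)

/-- Membership in `𝒜_loc`: `f ∈ L^∞(𝒜, P)` and `∫ ‖f(ω,x)‖ P(dω) ≤ A e^{-λ|x|}`, with the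
operator norm on `M_N`. -/
structure MemLoc (B : MagneticForm d) (P : Measure Ω) (f : Obs Ω d N) : Prop
    extends MemLInfty B P f where
  decay : ∃ A > 0, ∃ l > 0, ∀ x : Lat d,
    ∫⁻ ω, ‖Matrix.toEuclideanCLM (𝕜 := ℂ) (f ω x)‖ₑ ∂P
      ≤ ENNReal.ofReal (A * Real.exp (-l * latNorm x))

/-- For the given `ω` and `x₀`, the triple `(ℋ, F_{x₀}, π_ω ⊗ id)` satisfies the axioms of a
`p`-summable odd Fredholm module for all the observables in `S`: the operators `π_ω(f) ⊗ id` exist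
as bounded operators, the `*`-algebra operations are respected, `F_{x₀}` is a self-adjoint
involution, and the commutators are compact and in the `p`-th Schatten class. -/
structure IsSummableModuleOn (B : MagneticForm d)
    (σ : Fin d → Matrix (Fin (spinDim d)) (Fin (spinDim d)) ℂ) (p : ℕ) (ω : Ω) (x₀ : Fin d → ℝ)
    (S : Set (Obs Ω d N)) : Prop where
  hasKernel : ∀ f ∈ S, HasKernel (spinOp B ω f) (spinKernel B ω f)
  map_one : spinOp B ω (unitObs : Obs Ω d N) = 1
  map_add : ∀ f ∈ S, ∀ g ∈ S, spinOp B ω (f + g) = spinOp B ω f + spinOp B ω g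
  map_smul : ∀ (c : ℂ), ∀ f ∈ S, spinOp B ω (c • f) = c • spinOp B ω f
  map_mul : ∀ f ∈ S, ∀ g ∈ S, spinOp B ω (conv B f g) = spinOp B ω f * spinOp B ω g
  map_star : ∀ f ∈ S, spinOp B ω (invol f) = ContinuousLinearMap.adjoint (spinOp B ω f)
  hasKernel_phase : HasKernel (diracPhase σ x₀ N) (phaseKernel σ x₀ N)
  selfAdjoint : ContinuousLinearMap.adjoint (diracPhase σ x₀ N) = diracPhase σ x₀ N
  involutive : diracPhase σ x₀ N * diracPhase σ x₀ N = 1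
  compact : ∀ f ∈ S, IsCompactOperator
    (diracPhase σ x₀ N * spinOp B ω f - spinOp B ω f * diracPhase σ x₀ N)
  summable : ∀ f ∈ S, IsSchatten p
    (diracPhase σ x₀ N * spinOp B ω f - spinOp B ω f * diracPhase σ x₀ N)

end Localized

/-- The unit cube `[0,1]^d`. -/
def unitCube (d : ℕ) : Set (Fin d → ℝ) := Set.Icc 0 1

end OddChern

end

noncomputable section

namespace OddChern

open MeasureTheory
open scoped MatrixOrder ENNReal lp CompactlySupported

universe u

/-! ### Kernels of bounded operators on `ℓ²` -/

section Kernels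

variable {ι : Type*}

/-! The commutator of the Dirac phase with `π_ω(f) ⊗ id` has the kernel `(F(x) - F(y)) π_ω(f)(x,y)`,
where `F(x)` is the phase on the fibre over `x`. Since `F(x)` depends only on the direction of `x +
x₀`, it varies slowly: its entries satisfy `|F(x) - F(y)| ≤ C (1+|y-x|)/(1+|x|)`, uniformly in `x₀`
in the unit cube (`norm_phaseFiber_sub_le`). The `(d+1)`-th power of this bound is summable over `x
∈ ℤ^d`, and the factor `1+|y-x|` is paid for by the decay of `f`.

To pass from kernels to Schatten norms, take weights `W` with row and column sums at most `C`.
Cauchy-Schwarz gives `‖Tψ‖² ≤ ∑ δ_j |ψ_j|²` with `δ_j = C ∑_i |K(i,j)|²/W(i,j)`, so `T*T` is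
dominated by a diagonal operator. If `∑ δ_j^k` is finite then `δ → 0`, so `T` is compact, and
Jensen's inequality in an eigenbasis of `T*T` gives `Tr (T*T)^k ≤ ∑ δ_j^k`. A further power mean
inequality bounds this by `C^(2k-1) ∑ W^(-(2k-1)) |K|^(2k)`
(`compact_and_schattenTrace_le_of_kernel`). As `d` is odd, `d+1 = 2k`, and `|T|^(d+1) = (T*T)^k` is
a polynomial in `T` and `T*`.

With `W = e^{-ε|x-y|}` the resulting bound is a constant times `weightedMass ε f ω`, in which `x₀`
does not occur (`commutator_compact_and_schattenTrace_le`). For finite range `f` the mass is finite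
at every `ω`. For `f ∈ 𝒜_loc`, almost sure boundedness gives `|f|^(d+1) ≤ c^d |f|`; by invariance of
the measure and the exponential decay of the mean, the expected mass is finite once `ε` is small
(`MemLoc.exists_lintegral_weightedMass_ne_top`). This yields both the almost sure statement,
simultaneously in `x₀`, and the averaged bound. -/

theorem enorm_sq_eq_tsum (ψ : ℓ²(ι, ℂ)) : ‖ψ‖ₑ ^ 2 = ∑' i, ‖ψ i‖ₑ ^ 2 := by
  have h := lp.hasSum_norm (p := 2) (by simp) ψ
  simp only [ENNReal.toReal_ofNat, Real.rpow_ofNat] at h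
  simp only [← ofReal_norm, ← ENNReal.ofReal_pow (norm_nonneg _)]
  rw [← h.tsum_eq, ENNReal.ofReal_tsum_of_nonneg (fun _ => by positivity) h.summable]

theorem memℓp_two_of_tsum_ne_top {f : ι → ℂ} (h : ∑' i, ‖f i‖ₑ ^ 2 ≠ ∞) : Memℓp f 2 := by
  refine memℓp_gen ?_
  simp only [ENNReal.toReal_ofNat, Real.rpow_ofNat]
  have := ENNReal.summable_toReal h
  simpa [ENNReal.toReal_pow] using this

open Classical in
/-- The standard basis vector of `ℓ²(ι)` at `i`. -/
def stdVec (i : ι) : ℓ²(ι, ℂ) := lp.single 2 i 1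

theorem stdVec_apply_self (i : ι) : (stdVec i : ℓ²(ι, ℂ)) i = 1 := by
  classical
  rw [stdVec, lp.single_apply_self]

theorem stdVec_apply_ne {i j : ι} (h : j ≠ i) : (stdVec i : ℓ²(ι, ℂ)) j = 0 := by
  classical
  rw [stdVec, lp.single_apply_ne _ _ _ h]

theorem stdVec_apply [DecidableEq ι] (i j : ι) :
    (stdVec i : ℓ²(ι, ℂ)) j = if j = i then 1 else 0 := by
  split_ifs with h
  · rw [h, stdVec_apply_self]
  · exact stdVec_apply_ne h

theorem inner_stdVec_left (i : ι) (ψ : ℓ²(ι, ℂ)) : inner ℂ (stdVec i) ψ = ψ i := by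
  classical
  rw [stdVec, lp.inner_single_left]
  simp

theorem hasSum_stdVec (ψ : ℓ²(ι, ℂ)) : HasSum (fun i => ψ i • stdVec i) ψ := by
  classical
  have h := lp.hasSum_single (p := 2) (by simp) ψ
  convert h using 2 with i
  rw [stdVec, ← lp.single_smul]
  simp

theorem norm_stdVec (i : ι) : ‖(stdVec i : ℓ²(ι, ℂ))‖ = 1 := by
  classical
  rw [stdVec, lp.norm_single (by simp), norm_one]

/-- The matrix entries of a bounded operator on `ℓ²`. -/
def entry (T : ℓ²(ι, ℂ) →L[ℂ] ℓ²(ι, ℂ)) (i j : ι) : ℂ := T (stdVec j) i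

theorem norm_entry_le (T : ℓ²(ι, ℂ) →L[ℂ] ℓ²(ι, ℂ)) (i j : ι) : ‖entry T i j‖ ≤ ‖T‖ := by
  refine (lp.norm_apply_le_norm (by simp) _ i).trans ?_
  simpa [norm_stdVec] using T.le_opNorm (stdVec j)

theorem entry_eq_inner (T : ℓ²(ι, ℂ) →L[ℂ] ℓ²(ι, ℂ)) (i j : ι) :
    entry T i j = inner ℂ (stdVec i) (T (stdVec j)) := (inner_stdVec_left _ _).symm

/-- Evaluation at a point as a continuous functional on `ℓ²`. -/
def evalCLM (i : ι) : ℓ²(ι, ℂ) →L[ℂ] ℂ := innerSL ℂ (stdVec i)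

theorem evalCLM_apply (i : ι) (ψ : ℓ²(ι, ℂ)) : evalCLM i ψ = ψ i := inner_stdVec_left i ψ

theorem hasKernel_entry (T : ℓ²(ι, ℂ) →L[ℂ] ℓ²(ι, ℂ)) : HasKernel T (entry T) := by
  intro ψ i
  have h := (hasSum_stdVec ψ).mapL (evalCLM i ∘L T)
  simpa [evalCLM_apply, entry, mul_comm] using h

theorem HasKernel.eq_entry {T : ℓ²(ι, ℂ) →L[ℂ] ℓ²(ι, ℂ)} {K : ι → ι → ℂ} (h : HasKernel T K) :
    K = entry T := by
  classical
  ext i j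
  have h1 := h (stdVec j) i
  have h2 : HasSum (fun l => K i l * (stdVec j : ℓ²(ι, ℂ)) l) (K i j) := by
    convert hasSum_ite_eq j (K i j) using 2 with l
    rw [stdVec_apply]
    split_ifs with hl <;> simp [hl]
  exact h2.unique h1

/-- By continuity a bounded operator is determined by its values on the standard basis. Operator
identities below therefore reduce to identities between matrix entries. -/
theorem hasKernel_iff {T : ℓ²(ι, ℂ) →L[ℂ] ℓ²(ι, ℂ)} {K : ι → ι → ℂ} :
    HasKernel T K ↔ ∀ i j, entry T i j = K i j :=
  ⟨fun h i j => by rw [h.eq_entry], fun h => by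
    rw [show K = entry T from funext₂ fun i j => (h i j).symm]; exact hasKernel_entry T⟩

theorem HasKernel.unique {T S : ℓ²(ι, ℂ) →L[ℂ] ℓ²(ι, ℂ)} {K : ι → ι → ℂ} (hT : HasKernel T K)
    (hS : HasKernel S K) : T = S := by
  ext ψ
  exact (hT ψ _).unique (hS ψ _)

theorem HasKernel.kernelOp_eq {T : ℓ²(ι, ℂ) →L[ℂ] ℓ²(ι, ℂ)} {K : ι → ι → ℂ}
    (hT : HasKernel T K) : kernelOp K = T := by
  have h : ∃ T : ℓ²(ι, ℂ) →L[ℂ] ℓ²(ι, ℂ), HasKernel T K := ⟨T, hT⟩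
  rw [kernelOp, dif_pos h]
  exact h.choose_spec.unique hT

theorem HasKernel.kernelOp {T : ℓ²(ι, ℂ) →L[ℂ] ℓ²(ι, ℂ)} {K : ι → ι → ℂ}
    (hT : HasKernel T K) : HasKernel (kernelOp K) K := by
  rwa [hT.kernelOp_eq]

theorem entry_add (T S : ℓ²(ι, ℂ) →L[ℂ] ℓ²(ι, ℂ)) (i j : ι) :
    entry (T + S) i j = entry T i j + entry S i j := rfl

theorem entry_sub (T S : ℓ²(ι, ℂ) →L[ℂ] ℓ²(ι, ℂ)) (i j : ι) :
    entry (T - S) i j = entry T i j - entry S i j := rfl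

theorem entry_smul (c : ℂ) (T : ℓ²(ι, ℂ) →L[ℂ] ℓ²(ι, ℂ)) (i j : ι) :
    entry (c • T) i j = c * entry T i j := rfl

theorem entry_one [DecidableEq ι] (i j : ι) :
    entry (1 : ℓ²(ι, ℂ) →L[ℂ] ℓ²(ι, ℂ)) i j = if i = j then 1 else 0 :=
  stdVec_apply j i

theorem entry_adjoint (T : ℓ²(ι, ℂ) →L[ℂ] ℓ²(ι, ℂ)) (i j : ι) :
    entry (ContinuousLinearMap.adjoint T) i j = star (entry T j i) := by
  rw [entry_eq_inner, entry_eq_inner, ContinuousLinearMap.adjoint_inner_right,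
    ← inner_conj_symm]
  rfl

theorem hasSum_entry_mul (T S : ℓ²(ι, ℂ) →L[ℂ] ℓ²(ι, ℂ)) (i j : ι) :
    HasSum (fun l => entry T i l * entry S l j) (entry (T * S) i j) :=
  hasKernel_entry T (S (stdVec j)) i

theorem HasKernel.mul {T S : ℓ²(ι, ℂ) →L[ℂ] ℓ²(ι, ℂ)} {K L M : ι → ι → ℂ} (hT : HasKernel T K)
    (hS : HasKernel S L) (hM : ∀ i j, HasSum (fun l => K i l * L l j) (M i j)) :
    HasKernel (T * S) M := by
  refine hasKernel_iff.2 fun i j => (hasSum_entry_mul T S i j).unique ?_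
  rw [← hT.eq_entry, ← hS.eq_entry]
  exact hM i j

/-- A kernel that maps `ℓ²` boundedly into `ℓ²` is the kernel of a bounded operator. -/
theorem exists_hasKernel {K : ι → ι → ℂ} {C : ℝ} (hC : 0 ≤ C)
    (hs : ∀ (ψ : ℓ²(ι, ℂ)) i, Summable fun j => K i j * ψ j)
    (hb : ∀ ψ : ℓ²(ι, ℂ), ∑' i, ‖∑' j, K i j * ψ j‖ₑ ^ 2 ≤ ENNReal.ofReal C ^ 2 * ‖ψ‖ₑ ^ 2) :
    ∃ T : ℓ²(ι, ℂ) →L[ℂ] ℓ²(ι, ℂ), HasKernel T K ∧ ‖T‖ ≤ C := by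
  have hm : ∀ ψ : ℓ²(ι, ℂ), Memℓp (fun i => ∑' j, K i j * ψ j) 2 := fun ψ =>
    memℓp_two_of_tsum_ne_top (ne_top_of_le_ne_top
      (ENNReal.mul_ne_top (by simp) (by simp)) (hb ψ))
  let T₀ : ℓ²(ι, ℂ) →ₗ[ℂ] ℓ²(ι, ℂ) :=
    { toFun := fun ψ => ⟨fun i => ∑' j, K i j * ψ j, hm ψ⟩
      map_add' := fun ψ φ => by
        ext i
        simp only [lp.coeFn_add, Pi.add_apply, mul_add]
        exact (hs ψ i).tsum_add (hs φ i)
      map_smul' := fun c ψ => by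
        ext i
        simp only [lp.coeFn_smul, Pi.smul_apply, smul_eq_mul, RingHom.id_apply]
        rw [← tsum_mul_left]
        exact tsum_congr fun j => by ring }
  have hT₀ : ∀ ψ, ‖T₀ ψ‖ ≤ C * ‖ψ‖ := by
    intro ψ
    have h := hb ψ
    rw [← mul_pow, ← enorm_sq_eq_tsum (⟨_, hm ψ⟩ : ℓ²(ι, ℂ)),
      ENNReal.pow_le_pow_left_iff two_ne_zero] at h
    have h' := ENNReal.toReal_mono (ENNReal.mul_ne_top (by simp) (by simp)) h
    simp only [ENNReal.toReal_mul, toReal_enorm, ENNReal.toReal_ofReal hC] at h'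
    exact h'
  refine ⟨T₀.mkContinuous C hT₀, fun ψ i => (hs ψ i).hasSum, T₀.mkContinuous_norm_le hC hT₀⟩

end Kernels

/-! ### Weighted power mean inequality for series -/

/-- Hölder's inequality with weights `w` on finite partial sums, followed by a limit. The case `k =
2` is Cauchy-Schwarz; when the weights sum to one it is Jensen's inequality for `t ↦ t^k`. -/
theorem tsum_mul_pow_le {ι : Type*} {k : ℕ} (hk : 1 ≤ k) (w a : ι → ℝ≥0∞) :
    (∑' i, w i * a i) ^ k ≤ (∑' i, w i) ^ (k - 1) * ∑' i, w i * a i ^ k := by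
  have hk0 : (k : ℝ) ≠ 0 := by positivity
  have key : ∀ s : Finset ι, (∑ i ∈ s, w i * a i) ^ k ≤
      (∑' i, w i) ^ (k - 1) * ∑' i, w i * a i ^ k := by
    intro s
    have h := ENNReal.inner_le_weight_mul_Lp_of_nonneg s (p := k) (by exact_mod_cast hk) w a
    have h2 := pow_le_pow_left₀ (by simp) h k
    rw [mul_pow, ← ENNReal.rpow_mul_natCast, ← ENNReal.rpow_mul_natCast, inv_mul_cancel₀ hk0,
      sub_mul, inv_mul_cancel₀ hk0, ENNReal.rpow_one, one_mul,
      show (k : ℝ) - 1 = ((k - 1 : ℕ) : ℝ) by push_cast [hk]; ring, ENNReal.rpow_natCast] at h2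
    simp only [ENNReal.rpow_natCast] at h2
    refine h2.trans ?_
    gcongr
    · exact ENNReal.sum_le_tsum s
    · exact ENNReal.sum_le_tsum s
  have ht : Filter.Tendsto (fun s : Finset ι => (∑ i ∈ s, w i * a i) ^ k) Filter.atTop
      (nhds ((∑' i, w i * a i) ^ k)) :=
    ((ENNReal.continuous_pow k).tendsto _).comp ENNReal.summable.hasSum
  exact le_of_tendsto' ht key

/-- **Schur test**. -/
theorem exists_hasKernel_of_schur {ι : Type*} {K : ι → ι → ℂ} {C : ℝ} (hC : 0 ≤ C)
    (hr : ∀ i, ∑' j, ‖K i j‖ₑ ≤ ENNReal.ofReal C) (hc : ∀ j, ∑' i, ‖K i j‖ₑ ≤ ENNReal.ofReal C) :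
    ∃ T : ℓ²(ι, ℂ) →L[ℂ] ℓ²(ι, ℂ), HasKernel T K ∧ ‖T‖ ≤ C := by
  -- Cauchy-Schwarz with the row `‖K i j‖` as weight; its total mass is at most `C`.
  have hrow : ∀ (ψ : ℓ²(ι, ℂ)) i, (∑' j, ‖K i j * ψ j‖ₑ) ^ 2 ≤
      ENNReal.ofReal C * ∑' j, ‖K i j‖ₑ * ‖ψ j‖ₑ ^ 2 := by
    intro ψ i
    simp only [enorm_mul]
    refine (tsum_mul_pow_le one_le_two _ _).trans ?_
    gcongr
    simpa using hr i
  have htot : ∀ ψ : ℓ²(ι, ℂ), ∑' i, (∑' j, ‖K i j * ψ j‖ₑ) ^ 2 ≤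
      ENNReal.ofReal C ^ 2 * ‖ψ‖ₑ ^ 2 := by
    intro ψ
    calc ∑' i, (∑' j, ‖K i j * ψ j‖ₑ) ^ 2
        ≤ ∑' i, ENNReal.ofReal C * ∑' j, ‖K i j‖ₑ * ‖ψ j‖ₑ ^ 2 := ENNReal.tsum_le_tsum (hrow ψ)
      _ = ENNReal.ofReal C * ∑' j, (∑' i, ‖K i j‖ₑ) * ‖ψ j‖ₑ ^ 2 := by
          rw [ENNReal.tsum_mul_left, ENNReal.tsum_comm]
          simp only [ENNReal.tsum_mul_right]
      _ ≤ ENNReal.ofReal C * ∑' j, ENNReal.ofReal C * ‖ψ j‖ₑ ^ 2 := by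
          gcongr with j
          exact hc j
      _ = ENNReal.ofReal C ^ 2 * ‖ψ‖ₑ ^ 2 := by
          rw [ENNReal.tsum_mul_left, enorm_sq_eq_tsum]
          ring
  have hsum : ∀ (ψ : ℓ²(ι, ℂ)) i, Summable fun j => K i j * ψ j := by
    intro ψ i
    have h1 : (∑' j, ‖K i j * ψ j‖ₑ) ^ 2 ≠ ∞ := ne_top_of_le_ne_top
      (ENNReal.mul_ne_top (by simp) (by simp)) ((ENNReal.le_tsum i).trans (htot ψ))
    refine Summable.of_norm ?_
    have := ENNReal.summable_toReal (f := fun j => ‖K i j * ψ j‖ₑ) (fun h => h1 (by rw [h]; simp))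
    simpa only [toReal_enorm] using this
  refine exists_hasKernel hC hsum fun ψ => le_trans ?_ (htot ψ)
  gcongr with i
  exact enorm_tsum_le_tsum_enorm

/-! ### Traces of powers -/

section Trace

variable {H : Type*} [NormedAddCommGroup H] [InnerProductSpace ℂ H]
  {κ : Type*}

theorem enorm_sq_eq_tsum_inner (b : HilbertBasis κ ℂ H) (x : H) :
    ‖x‖ₑ ^ 2 = ∑' i, ‖inner ℂ (b i) x‖ₑ ^ 2 := by
  have h := enorm_sq_eq_tsum (b.repr x)
  simp only [b.repr_apply_apply] at h
  rw [← h, ← ofReal_norm, ← ofReal_norm, b.repr.norm_map]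

/-- Bessel's inequality, for the finite families over which `posTrace` is a supremum. -/
theorem sum_enorm_inner_sq_le {s : Finset H} (hs : Orthonormal ℂ (Subtype.val : s → H)) (x : H) :
    ∑ e ∈ s, ‖inner ℂ e x‖ₑ ^ 2 ≤ ‖x‖ₑ ^ 2 := by
  have h := hs.sum_inner_products_le x (s := Finset.univ)
  rw [Finset.sum_coe_sort s (fun e => ‖inner ℂ e x‖ ^ 2)] at h
  have h' := ENNReal.ofReal_le_ofReal h
  rw [ENNReal.ofReal_sum_of_nonneg (fun _ _ => by positivity)] at h'
  simpa only [← ofReal_norm, ENNReal.ofReal_pow (norm_nonneg _)] using h'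

variable [CompleteSpace H]

theorem ofReal_re_inner_star_mul (S : H →L[ℂ] H) (e : H) :
    ENNReal.ofReal (inner ℂ e ((star S * S) e)).re = ‖S e‖ₑ ^ 2 := by
  rw [ContinuousLinearMap.star_eq_adjoint, mul_apply_eq_comp,
    ContinuousLinearMap.adjoint_inner_right, ← ofReal_norm, ← ENNReal.ofReal_pow (norm_nonneg _)]
  congr 1
  exact inner_self_eq_norm_sq (𝕜 := ℂ) _

/-- The trace of a positive operator can be computed in any orthonormal basis. -/
theorem posTrace_star_mul {S : H →L[ℂ] H} (hS : IsSelfAdjoint S) (b : HilbertBasis κ ℂ H) :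
    posTrace (star S * S) = ∑' i, ENNReal.ofReal (inner ℂ (b i) ((star S * S) (b i))).re := by
  classical
  unfold posTrace
  simp only [ofReal_re_inner_star_mul]
  apply le_antisymm
  -- Expand each `S e` in the basis, move `S` to the other side of the inner product by
  -- self-adjointness, exchange the sums and apply Bessel to `S (b i)`.
  · refine iSup₂_le fun s hs => ?_
    calc ∑ e ∈ s, ‖S e‖ₑ ^ 2 = ∑ e ∈ s, ∑' i, ‖inner ℂ e (S (b i))‖ₑ ^ 2 := by
          refine Finset.sum_congr rfl fun e _ => ?_
          rw [enorm_sq_eq_tsum_inner b]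
          refine tsum_congr fun i => ?_
          have h1 : inner ℂ (b i) (S e) = inner ℂ (S (b i)) e :=
            (ContinuousLinearMap.isSelfAdjoint_iff_isSymmetric.1 hS (b i) e).symm
          rw [h1, ← ofReal_norm, norm_inner_symm, ofReal_norm]
      _ = ∑' i, ∑ e ∈ s, ‖inner ℂ e (S (b i))‖ₑ ^ 2 :=
          (Summable.tsum_finsetSum fun _ _ => ENNReal.summable).symm
      _ ≤ _ := ENNReal.tsum_le_tsum fun i => sum_enorm_inner_sq_le hs _
  -- Finite parts of the basis are themselves orthonormal families in the supremum.
  · rw [ENNReal.tsum_eq_iSup_sum]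
    refine iSup_le fun t => ?_
    have ho : Orthonormal ℂ (Subtype.val : {x // x ∈ t.image b} → H) := by
      have h1 := b.orthonormal.toSubtypeRange
      refine h1.comp (fun x : {x // x ∈ t.image b} => (⟨x.1, ?_⟩ : Set.range b)) ?_
      · obtain ⟨i, -, hi⟩ := Finset.mem_image.1 x.2
        exact ⟨i, hi⟩
      · intro x y hxy
        exact Subtype.ext (congrArg (fun z : Set.range b => z.1) hxy)
    refine le_trans ?_ (le_iSup₂ (t.image b) ho)
    rw [Finset.sum_image fun i _ j _ hij => b.orthonormal.linearIndependent.injective hij]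

theorem abs_pow_two_mul (k : ℕ) (T : H →L[ℂ] H) : CFC.abs T ^ (2 * k) = (star T * T) ^ k := by
  rw [pow_mul, CFC.abs_sq]

/-- An even exponent removes the square root in `|T|`. Writing the power as `(|T|^k)* |T|^k` puts it
in the form for which the trace does not depend on the basis. -/
theorem schattenTrace_two_mul (k : ℕ) (T : H →L[ℂ] H) (b : HilbertBasis κ ℂ H) :
    schattenTrace (2 * k) T =
      ∑' i, ENNReal.ofReal (inner ℂ (b i) (((star T * T) ^ k) (b i))).re := by
  have hS : IsSelfAdjoint (CFC.abs T ^ k) :=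
    (IsSelfAdjoint.of_nonneg (CFC.abs_nonneg T)).pow k
  have h : (star T * T) ^ k = star (CFC.abs T ^ k) * CFC.abs T ^ k := by
    rw [hS.star_eq, ← pow_add, ← two_mul, abs_pow_two_mul]
  rw [schattenTrace, abs_pow_two_mul, h]
  exact posTrace_star_mul hS b

/-- A compact self-adjoint operator has an orthonormal basis of eigenvectors. -/
theorem exists_hilbertBasis_eigenvectors {H : Type u} [NormedAddCommGroup H]
    [InnerProductSpace ℂ H] [CompleteSpace H] {A : H →L[ℂ] H} (hA : IsCompactOperator A)
    (hs : IsSelfAdjoint A) :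
    ∃ (κ : Type u) (b : HilbertBasis κ ℂ H) (l : κ → ℂ), ∀ i, A (b i) = l i • b i := by
  have hsym : (A : H →ₗ[ℂ] H).IsSymmetric := ContinuousLinearMap.isSelfAdjoint_iff_isSymmetric.1 hs
  let V : ℂ → Submodule ℂ H := fun μ => Module.End.eigenspace (A : Module.End ℂ H) μ
  have hclosed : ∀ μ, CompleteSpace (V μ) := by
    intro μ
    have : IsClosed (V μ : Set H) := by
      have : (V μ : Set H) = {x | A x = μ • x} := by
        ext x
        simp [V]
      rw [this]
      exact isClosed_eq A.continuous (continuous_const_smul μ)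
    exact this.completeSpace_coe
  choose w c hc using fun μ => exists_hilbertBasis ℂ (V μ)
  have hon : Orthonormal ℂ fun a : Σ μ, w μ => ((c a.1 a.2 : V a.1) : H) :=
    hsym.orthogonalFamily_eigenspaces.orthonormal_sigma_orthonormal
    (v_family := fun μ i => c μ i) fun μ => (c μ).orthonormal
  -- A vector orthogonal to the bases of all eigenspaces is orthogonal to the eigenspaces, so the
  -- spectral theorem forces it to vanish.
  have hbot : (Submodule.span ℂ (Set.range fun a : Σ μ, w μ => ((c a.1 a.2 : V a.1) : H)))ᗮ = ⊥ := by
    rw [eq_bot_iff, ← ContinuousLinearMap.orthogonalComplement_iSup_eigenspaces_eq_bot hA hsym]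
    intro x hx
    rw [Submodule.mem_orthogonal] at hx ⊢
    have key : ∀ μ, V μ ≤ (Submodule.span ℂ {x})ᗮ := by
      intro μ v hv
      have h := ((c μ).hasSum_repr ⟨v, hv⟩).mapL (innerSL ℂ x ∘L (V μ).subtypeL)
      have h0 : ∀ i, (innerSL ℂ x ∘L (V μ).subtypeL) ((c μ).repr ⟨v, hv⟩ i • c μ i) = 0 := by
        intro i
        have h1 := hx (c μ i : V μ) (Submodule.subset_span ⟨⟨μ, i⟩, rfl⟩)
        rw [inner_eq_zero_symm] at h1
        simp [h1]
      simp only [h0] at h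
      have h2 := h.unique hasSum_zero
      rw [Submodule.mem_orthogonal_singleton_iff_inner_right]
      simpa using h2
    intro u hu
    have := (iSup_le key : (⨆ μ, V μ) ≤ _) hu
    rw [Submodule.mem_orthogonal_singleton_iff_inner_left] at this
    exact this
  refine ⟨Σ μ, w μ, HilbertBasis.mkOfOrthogonalEqBot hon hbot, fun a => a.1, fun a => ?_⟩
  rw [HilbertBasis.coe_mkOfOrthogonalEqBot]
  exact Module.End.mem_eigenspace_iff.1 (c a.1 a.2).2

end Trace

/-! ### Operators dominated by a diagonal -/

section Diagonal

variable {ι : Type*}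

theorem isCompactOperator_smulRight (φ : ℓ²(ι, ℂ) →L[ℂ] ℂ) (v : ℓ²(ι, ℂ)) :
    IsCompactOperator (φ.smulRight v) := by
  have h : IsCompactOperator (ContinuousLinearMap.toSpanSingleton ℂ v) :=
    isCompactOperator_of_locallyCompactSpace_rng _
  exact h.comp_clm φ

/-- Cutting `ψ` off to a finite set `s` of coordinates gives finite rank operators `T ∘L R s`, and
`‖T ∘L R s - T‖²` is at most the supremum of `δ` off `s`, which tends to zero. -/
theorem isCompactOperator_of_diagonal {T : ℓ²(ι, ℂ) →L[ℂ] ℓ²(ι, ℂ)} {δ : ι → ℝ≥0∞}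
    (hT : ∀ ψ, ‖T ψ‖ₑ ^ 2 ≤ ∑' i, δ i * ‖ψ i‖ₑ ^ 2)
    (hδ : Filter.Tendsto δ Filter.cofinite (nhds 0)) : IsCompactOperator T := by
  classical
  let R : Finset ι → (ℓ²(ι, ℂ) →L[ℂ] ℓ²(ι, ℂ)) := fun s =>
    ∑ i ∈ s, (evalCLM i).smulRight (stdVec i)
  have hR : ∀ s ψ j, R s ψ j = if j ∈ s then ψ j else 0 := by
    intro s ψ j
    simp only [R, sum_apply, ContinuousLinearMap.smulRight_apply,
      evalCLM_apply, lp.coeFn_sum, Finset.sum_apply, lp.coeFn_smul, Pi.smul_apply, smul_eq_mul,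
      stdVec_apply]
    simp
  have hcomp : ∀ s, IsCompactOperator (T ∘L R s) := by
    intro s
    have : T ∘L R s = ∑ i ∈ s, (evalCLM i).smulRight (T (stdVec i)) := by
      ext1 ψ
      simp [R]
    rw [this]
    refine Finset.sum_induction _ (fun A : ℓ²(ι, ℂ) →L[ℂ] ℓ²(ι, ℂ) => IsCompactOperator A)
      (fun A B hA hB => hA.add hB) isCompactOperator_zero
      fun i _ => isCompactOperator_smulRight _ _
  refine isCompactOperator_of_tendsto (l := Filter.atTop) (F := fun s => T ∘L R s) ?_
    (Filter.Eventually.of_forall hcomp)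
  rw [Metric.tendsto_atTop]
  intro ε hε
  -- Off a finite set `δ ≤ (ε/2)²`, which bounds the norm by `ε/2`; the halving makes the final
  -- inequality strict.
  have hε2 : (0 : ℝ≥0∞) < ENNReal.ofReal ((ε / 2) ^ 2) := by
    rw [ENNReal.ofReal_pos]; positivity
  have hfin := hδ.eventually (ge_mem_nhds hε2)
  rw [Filter.eventually_cofinite] at hfin
  refine ⟨hfin.toFinset, fun s hs => ?_⟩
  rw [dist_eq_norm]
  refine lt_of_le_of_lt (ContinuousLinearMap.opNorm_le_bound _ (half_pos hε).le fun ψ => ?_)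
    (half_lt_self hε)
  have e1 : (T ∘L R s - T) ψ = T (R s ψ - ψ) := by simp
  have e2 : ‖T (R s ψ - ψ)‖ₑ ^ 2 ≤ (ENNReal.ofReal (ε / 2) * ‖ψ‖ₑ) ^ 2 := by
    refine (hT _).trans ?_
    rw [mul_pow, enorm_sq_eq_tsum ψ, ← ENNReal.tsum_mul_left, ← ENNReal.ofReal_pow (by positivity)]
    refine ENNReal.tsum_le_tsum fun i => ?_
    rw [lp.coeFn_sub, Pi.sub_apply, hR]
    split_ifs with hi
    · simp
    · have hi' : i ∉ hfin.toFinset := fun h => hi (hs h)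
      simp only [Set.Finite.mem_toFinset, Set.mem_ofPred_eq, not_not] at hi'
      simp only [zero_sub, enorm_neg]
      gcongr
  rw [ENNReal.pow_le_pow_left_iff two_ne_zero] at e2
  rw [e1]
  have h' := ENNReal.toReal_mono (ENNReal.mul_ne_top (by simp) (by simp)) e2
  simpa [(half_pos hε).le] using h'

theorem tendsto_cofinite_of_tsum_pow_ne_top {δ : ι → ℝ≥0∞} {k : ℕ} (hk : k ≠ 0)
    (h : ∑' i, δ i ^ k ≠ ∞) : Filter.Tendsto δ Filter.cofinite (nhds 0) := by
  have h1 := ENNReal.tendsto_cofinite_zero_of_tsum_ne_top h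
  have h2 := (ENNReal.continuous_rpow_const (y := (k : ℝ)⁻¹)).tendsto 0 |>.comp h1
  have hk' : (0 : ℝ) < k := by positivity
  rw [ENNReal.zero_rpow_of_pos (inv_pos.2 hk')] at h2
  refine h2.congr fun i => ?_
  simp [← ENNReal.rpow_natCast, ← ENNReal.rpow_mul, hk'.ne']

/-- The standard Hilbert basis of `ℓ²(ι)`. -/
def stdBasis (ι : Type*) : HilbertBasis ι ℂ ℓ²(ι, ℂ) := ⟨LinearIsometryEquiv.refl ℂ _⟩

theorem stdBasis_apply (i : ι) : stdBasis ι i = stdVec i := by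
  classical
  rw [← HilbertBasis.repr_symm_single]
  rfl

/-- If `T*T` is dominated by a diagonal operator with entries `δ`, then
`Tr(|T|^{2k}) ≤ ∑ δ^k`. -/
theorem schattenTrace_le_of_diagonal {T : ℓ²(ι, ℂ) →L[ℂ] ℓ²(ι, ℂ)} {δ : ι → ℝ≥0∞} {k : ℕ}
    (hk : 1 ≤ k) (hT : ∀ ψ, ‖T ψ‖ₑ ^ 2 ≤ ∑' i, δ i * ‖ψ i‖ₑ ^ 2)
    (hc : IsCompactOperator T) :
    schattenTrace (2 * k) T ≤ ∑' i, δ i ^ k := by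
  have hsa : IsSelfAdjoint (star T * T) := IsSelfAdjoint.star_mul_self T
  have hcomp : IsCompactOperator (star T * T) := hc.clm_comp (star T)
  obtain ⟨κ, b, l, hb⟩ := exists_hilbertBasis_eigenvectors hcomp hsa
  have hpow : ∀ i, ((star T * T) ^ k) (b i) = l i ^ k • b i := by
    intro i
    induction k with
    | zero => simp
    | succ n ih =>
      rcases Nat.eq_zero_or_pos n with rfl | hn
      · simp [hb]
      · rw [pow_succ', mul_apply_eq_comp, ih hn, map_smul, hb, smul_smul, pow_succ]
  have hinner : ∀ i, inner ℂ (b i) (b i) = (1 : ℂ) := fun i => by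
    rw [inner_self_eq_norm_sq_to_K, b.orthonormal.1 i]; simp
  have hl : ∀ i, l i = ((‖T (b i)‖ ^ 2 : ℝ) : ℂ) := by
    intro i
    have h1 : inner ℂ (b i) ((star T * T) (b i)) = l i := by
      rw [hb, inner_smul_right, hinner, mul_one]
    rw [← h1, ContinuousLinearMap.star_eq_adjoint, mul_apply_eq_comp,
      ContinuousLinearMap.adjoint_inner_right, inner_self_eq_norm_sq_to_K]
    simp
  have hterm : ∀ i, ENNReal.ofReal (inner ℂ (b i) (((star T * T) ^ k) (b i))).re
      = (‖T (b i)‖ₑ ^ 2) ^ k := by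
    intro i
    rw [hpow, inner_smul_right, hinner, mul_one, hl, ← Complex.ofReal_pow, Complex.ofReal_re,
      ENNReal.ofReal_pow (by positivity), ENNReal.ofReal_pow (by positivity), ofReal_norm]
  rw [schattenTrace_two_mul k T b]
  simp only [hterm]
  -- The array `|b_i(j)|²` is doubly stochastic: rows sum to one by normalisation, columns by
  -- Parseval for the standard basis vectors. Rows serve as the weights in Jensen's inequality,
  -- columns collapse the sum over `i`.
  have hone : ∀ i, ∑' j, ‖b i j‖ₑ ^ 2 = 1 := fun i => by
    rw [← enorm_sq_eq_tsum, ← ofReal_norm, b.orthonormal.1 i]; simp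
  have hone' : ∀ j, ∑' i, ‖b i j‖ₑ ^ 2 = 1 := fun j => by
    have h := enorm_sq_eq_tsum_inner b (stdVec j)
    rw [← ofReal_norm, norm_stdVec] at h
    simp only [ENNReal.ofReal_one, one_pow] at h
    rw [h]
    refine tsum_congr fun i => ?_
    rw [← inner_stdVec_left, ← ofReal_norm, ← ofReal_norm, norm_inner_symm]
  calc ∑' i, (‖T (b i)‖ₑ ^ 2) ^ k
      ≤ ∑' i, ∑' j, ‖b i j‖ₑ ^ 2 * δ j ^ k := by
        refine ENNReal.tsum_le_tsum fun i => ?_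
        refine (pow_le_pow_left₀ (by simp) (hT (b i)) k).trans ?_
        simp only [mul_comm (δ _)]
        refine (tsum_mul_pow_le hk _ _).trans ?_
        rw [hone, one_pow, one_mul]
    _ = ∑' j, δ j ^ k := by
        rw [ENNReal.tsum_comm]
        simp only [ENNReal.tsum_mul_right, hone', one_mul]

/-- Schatten bound for an operator in terms of weighted powers of its kernel. -/
theorem compact_and_schattenTrace_le_of_kernel {T : ℓ²(ι, ℂ) →L[ℂ] ℓ²(ι, ℂ)} {K : ι → ι → ℂ}
    (hT : HasKernel T K) {W : ι → ι → ℝ≥0∞} (hW0 : ∀ i j, W i j ≠ 0) (hWt : ∀ i j, W i j ≠ ∞)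
    {C : ℝ≥0∞} (hC : C ≠ ∞) (hr : ∀ i, ∑' j, W i j ≤ C) (hc : ∀ j, ∑' i, W i j ≤ C) {k : ℕ}
    (hk : 1 ≤ k) (hfin : ∑' i, ∑' j, (W i j)⁻¹ ^ (2 * k - 1) * ‖K i j‖ₑ ^ (2 * k) ≠ ∞) :
    IsCompactOperator T ∧ schattenTrace (2 * k) T ≤
      C ^ (2 * k - 1) * ∑' i, ∑' j, (W i j)⁻¹ ^ (2 * k - 1) * ‖K i j‖ₑ ^ (2 * k) := by
  have hWW : ∀ i j, W i j * (W i j)⁻¹ = 1 := fun i j => ENNReal.mul_inv_cancel (hW0 i j) (hWt i j)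
  -- Each summand is `‖K i j‖²/W i j`, kept in the form weight times square for `tsum_mul_pow_le`.
  let δ : ι → ℝ≥0∞ := fun j => C * ∑' i, W i j * ((W i j)⁻¹ * ‖K i j‖ₑ) ^ 2
  have hdiag : ∀ ψ, ‖T ψ‖ₑ ^ 2 ≤ ∑' j, δ j * ‖ψ j‖ₑ ^ 2 := by
    intro ψ
    rw [enorm_sq_eq_tsum]
    calc ∑' i, ‖T ψ i‖ₑ ^ 2
        ≤ ∑' i, C * ∑' j, W i j * ((W i j)⁻¹ * ‖K i j‖ₑ * ‖ψ j‖ₑ) ^ 2 := by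
          refine ENNReal.tsum_le_tsum fun i => ?_
          have h1 : ‖T ψ i‖ₑ ≤ ∑' j, W i j * ((W i j)⁻¹ * ‖K i j‖ₑ * ‖ψ j‖ₑ) := by
            rw [← (hT ψ i).tsum_eq]
            refine enorm_tsum_le_tsum_enorm.trans (ENNReal.tsum_le_tsum fun j => ?_)
            rw [← mul_assoc, ← mul_assoc, hWW, one_mul, enorm_mul]
          refine (pow_le_pow_left₀ (by simp) h1 2).trans
            ((tsum_mul_pow_le one_le_two _ _).trans ?_)
          gcongr
          simpa using hr i
      _ = ∑' j, δ j * ‖ψ j‖ₑ ^ 2 := by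
          rw [ENNReal.tsum_mul_left, ENNReal.tsum_comm, ← ENNReal.tsum_mul_left]
          refine tsum_congr fun j => ?_
          simp only [δ, mul_assoc, ← ENNReal.tsum_mul_right]
          congr 2
          ext i
          ring
  -- The factor `C^k` comes from the definition of `δ` and `C^(k-1)` from the power mean over a
  -- column of `W`; one of the `2k` inverse weights cancels against `W`.
  have hδ : ∑' j, δ j ^ k ≤
      C ^ (2 * k - 1) * ∑' i, ∑' j, (W i j)⁻¹ ^ (2 * k - 1) * ‖K i j‖ₑ ^ (2 * k) := by
    rw [ENNReal.tsum_comm, ← ENNReal.tsum_mul_left]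
    refine ENNReal.tsum_le_tsum fun j => ?_
    simp only [δ, mul_pow _ (∑' _, _)]
    calc C ^ k * (∑' i, W i j * ((W i j)⁻¹ * ‖K i j‖ₑ) ^ 2) ^ k
        ≤ C ^ k * (C ^ (k - 1) * ∑' i, W i j * (((W i j)⁻¹ * ‖K i j‖ₑ) ^ 2) ^ k) := by
          gcongr
          refine (tsum_mul_pow_le hk _ _).trans ?_
          gcongr
          exact hc j
      _ = _ := by
          rw [← mul_assoc, ← pow_add, show k + (k - 1) = 2 * k - 1 by omega]
          congr 2
          ext i
          obtain ⟨m, hm⟩ : ∃ m, 2 * k = m + 1 := ⟨2 * k - 1, by omega⟩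
          rw [← pow_mul, mul_pow, hm, Nat.add_sub_cancel, pow_succ (W i j)⁻¹, ← mul_assoc,
            mul_comm (_ ^ m), ← mul_assoc, hWW, one_mul]
  have hcomp := isCompactOperator_of_diagonal hdiag
    (tendsto_cofinite_of_tsum_pow_ne_top (by omega)
      (ne_top_of_le_ne_top (ENNReal.mul_ne_top (by simp [hC]) hfin) hδ))
  exact ⟨hcomp, (schattenTrace_le_of_diagonal hk hdiag hcomp).trans hδ⟩

end Diagonal

/-! ### Euclidean length of lattice vectors -/

section Length

variable {d : ℕ}

/-- The vector `x + x₀` in Euclidean space. -/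
def shiftedVec (x₀ : Fin d → ℝ) (x : Lat d) : EuclideanSpace ℝ (Fin d) :=
  WithLp.toLp 2 fun j => (x j : ℝ) + x₀ j

theorem shiftedVec_apply (x₀ : Fin d → ℝ) (x : Lat d) (j : Fin d) :
    shiftedVec x₀ x j = (x j : ℝ) + x₀ j := rfl

theorem latNorm_eq_norm (x : Lat d) : latNorm x = ‖shiftedVec 0 x‖ := by
  simp [latNorm, EuclideanSpace.norm_eq, shiftedVec_apply]

theorem latNorm_nonneg (x : Lat d) : 0 ≤ latNorm x := Real.sqrt_nonneg _

theorem latNorm_neg (x : Lat d) : latNorm (-x) = latNorm x := by simp [latNorm]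

theorem latNorm_zero : latNorm (0 : Lat d) = 0 := by simp [latNorm]

theorem latNorm_add_le (x y : Lat d) : latNorm (x + y) ≤ latNorm x + latNorm y := by
  simp only [latNorm_eq_norm]
  refine le_trans (le_of_eq ?_) (norm_add_le _ _)
  congr 1
  ext j
  simp [shiftedVec_apply]

theorem norm_shiftedVec_sub (x₀ : Fin d → ℝ) (x y : Lat d) :
    ‖shiftedVec x₀ x - shiftedVec x₀ y‖ = latNorm (y - x) := by
  rw [← neg_sub, norm_neg, latNorm_eq_norm]
  congr 1
  ext j
  simp [shiftedVec_apply]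

theorem norm_toLp_le_of_mem_unitCube {x₀ : Fin d → ℝ} (h : x₀ ∈ unitCube d) :
    ‖(WithLp.toLp 2 x₀ : EuclideanSpace ℝ (Fin d))‖ ≤ d := by
  rw [EuclideanSpace.norm_eq]
  refine Real.sqrt_le_iff.2 ⟨by positivity, ?_⟩
  calc ∑ i, ‖x₀ i‖ ^ 2 ≤ ∑ _i : Fin d, (1 : ℝ) := by
        refine Finset.sum_le_sum fun i _ => ?_
        have h0 : 0 ≤ x₀ i := h.1 i
        have h1 : x₀ i ≤ 1 := h.2 i
        rw [Real.norm_of_nonneg h0]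
        nlinarith
    _ = d := by simp
    _ ≤ (d : ℝ) ^ 2 := by exact_mod_cast Nat.le_self_pow two_ne_zero d

theorem latNorm_le_norm_shiftedVec {x₀ : Fin d → ℝ} (h : x₀ ∈ unitCube d) (x : Lat d) :
    latNorm x - d ≤ ‖shiftedVec x₀ x‖ := by
  have h1 : shiftedVec 0 x = shiftedVec x₀ x - WithLp.toLp 2 x₀ := by
    ext j
    simp [shiftedVec_apply]
  have h2 := norm_sub_le (shiftedVec x₀ x) (WithLp.toLp 2 x₀)
  rw [← h1, ← latNorm_eq_norm] at h2
  linarith [norm_toLp_le_of_mem_unitCube h]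

/-- Split the difference as `(a-b)/‖a‖` plus `(1/‖a‖ - 1/‖b‖) b`; both parts have norm at most
`‖a-b‖/‖a‖`. No lower bound on `‖b‖` enters. -/
theorem norm_normalize_sub_le {E : Type*} [NormedAddCommGroup E] [NormedSpace ℝ E] {a b : E}
    (ha : a ≠ 0) (hb : b ≠ 0) : ‖‖a‖⁻¹ • a - ‖b‖⁻¹ • b‖ ≤ 2 * ‖a - b‖ / ‖a‖ := by
  have ha' : 0 < ‖a‖ := norm_pos_iff.2 ha
  have hb' : 0 < ‖b‖ := norm_pos_iff.2 hb
  have h : ‖a‖⁻¹ • a - ‖b‖⁻¹ • b = ‖a‖⁻¹ • (a - b) + (‖a‖⁻¹ * (‖b‖ - ‖a‖) * ‖b‖⁻¹) • b := by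
    have : ‖a‖⁻¹ * (‖b‖ - ‖a‖) * ‖b‖⁻¹ = ‖a‖⁻¹ - ‖b‖⁻¹ := by field_simp
    rw [this, sub_smul, smul_sub]
    abel
  have h1 : |‖b‖ - ‖a‖| ≤ ‖a - b‖ := by
    rw [abs_sub_comm]; exact abs_norm_sub_norm_le a b
  rw [h]
  refine (norm_add_le _ _).trans ?_
  rw [norm_smul, norm_smul, Real.norm_eq_abs, Real.norm_eq_abs, abs_mul, abs_mul,
    abs_of_pos (inv_pos.2 ha'), abs_of_pos (inv_pos.2 hb'), mul_assoc, mul_assoc,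
    inv_mul_cancel₀ hb'.ne', mul_one, ← mul_add, div_eq_inv_mul]
  gcongr
  linarith

end Length

/-! ### The Dirac phase -/

section DiracPhase

variable {d : ℕ} {σ : Fin d → Matrix (Fin (spinDim d)) (Fin (spinDim d)) ℂ}

/-- Adding the double sum to its copy with exchanged indices produces anticommutators, of which only
the diagonal ones survive. -/
theorem IsCliffordRep.sum_smul_mul_self (hσ : IsCliffordRep σ) (v : Fin d → ℝ) :
    (∑ j, (v j : ℂ) • σ j) * (∑ j, (v j : ℂ) • σ j) = ((∑ j, v j ^ 2 : ℝ) : ℂ) • 1 := by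
  have h1 : (∑ j, (v j : ℂ) • σ j) * (∑ j, (v j : ℂ) • σ j) =
      ∑ i, ∑ j, ((v i : ℂ) * v j) • (σ i * σ j) := by
    rw [Finset.sum_mul_sum]
    simp only [smul_mul_smul_comm]
  have h2 : (∑ j, (v j : ℂ) • σ j) * (∑ j, (v j : ℂ) • σ j) =
      ∑ i, ∑ j, ((v i : ℂ) * v j) • (σ j * σ i) := by
    rw [h1, Finset.sum_comm]
    simp only [mul_comm]
  have h3 : (2 : ℂ) • ((∑ j, (v j : ℂ) • σ j) * (∑ j, (v j : ℂ) • σ j)) =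
      (2 : ℂ) • (((∑ j, v j ^ 2 : ℝ) : ℂ) • 1) := by
    rw [two_smul]
    nth_rw 1 [h1]
    rw [h2, ← Finset.sum_add_distrib]
    simp only [← Finset.sum_add_distrib, ← smul_add, hσ.anticomm]
    simp only [smul_ite, smul_zero, Finset.sum_ite_eq, Finset.mem_univ, if_true]
    rw [← Finset.sum_smul, smul_smul, mul_comm, ← smul_smul, show (2 : ℂ) • (1 : Matrix _ _ ℂ) = 2
      by rw [two_smul, one_add_one_eq_two]]
    push_cast
    simp only [pow_two]
  exact smul_right_injective _ (two_ne_zero' ℂ) h3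

open scoped ComplexOrder in
-- The positive square root of `D*D = s²` is the scalar `s`, so the phase is `D/s`.
theorem mul_inv_abs_of_sq {n : Type*} [Fintype n] [DecidableEq n] {D : Matrix n n ℂ} {s : ℝ}
    (hs : 0 < s) (hD : D.conjTranspose = D) (hDD : D * D = ((s ^ 2 : ℝ) : ℂ) • 1) :
    D * (CFC.abs D)⁻¹ = ((s⁻¹ : ℝ) : ℂ) • D := by
  have hpos : (0 : Matrix n n ℂ) ≤ (s : ℂ) • 1 := by
    rw [Matrix.nonneg_iff_posSemidef]
    exact Matrix.PosSemidef.one.smul (by exact_mod_cast hs.le)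
  have habs : CFC.abs D = (s : ℂ) • 1 := by
    rw [CFC.abs]
    refine CFC.sqrt_unique ?_ hpos
    rw [Matrix.star_eq_conjTranspose, hD, hDD]
    rw [smul_mul_smul_comm, one_mul, pow_two, Complex.ofReal_mul]
  have hinv : (CFC.abs D)⁻¹ = ((s⁻¹ : ℝ) : ℂ) • 1 := by
    refine Matrix.inv_eq_right_inv ?_
    rw [habs]
    have : (s : ℂ) ≠ 0 := by exact_mod_cast hs.ne'
    rw [smul_mul_smul_comm, one_mul, Complex.ofReal_inv, mul_inv_cancel₀ this, one_smul]
  rw [hinv]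
  simp

open Classical in
/-- The modulus of the Dirac operator on the fiber over `x`. -/
def diracRadius (x₀ : Fin d → ℝ) (x : Lat d) : ℝ :=
  if ∀ j, (x j : ℝ) + x₀ j = 0 then 1 else ‖shiftedVec x₀ x‖

theorem shiftedVec_eq_zero_iff (x₀ : Fin d → ℝ) (x : Lat d) :
    shiftedVec x₀ x = 0 ↔ ∀ j, (x j : ℝ) + x₀ j = 0 := by
  constructor
  · intro h j
    rw [← shiftedVec_apply, h]
    rfl
  · intro h
    ext j
    exact h j

theorem diracRadius_pos (x₀ : Fin d → ℝ) (x : Lat d) : 0 < diracRadius x₀ x := by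
  rw [diracRadius]
  split_ifs with h
  · exact one_pos
  · exact norm_pos_iff.2 (mt (shiftedVec_eq_zero_iff x₀ x).1 h)

theorem diracFiber_conjTranspose (hσ : IsCliffordRep σ) (x₀ : Fin d → ℝ) (x : Lat d) :
    (diracFiber σ x₀ x).conjTranspose = diracFiber σ x₀ x := by
  rw [diracFiber]
  split_ifs
  · simp
  · rw [Matrix.conjTranspose_sum]
    refine Finset.sum_congr rfl fun j _ => ?_
    rw [Matrix.conjTranspose_smul, hσ.selfAdjoint, Complex.star_def, Complex.conj_ofReal]

theorem diracFiber_mul_self (hσ : IsCliffordRep σ) (x₀ : Fin d → ℝ) (x : Lat d) :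
    diracFiber σ x₀ x * diracFiber σ x₀ x = ((diracRadius x₀ x ^ 2 : ℝ) : ℂ) • 1 := by
  rw [diracFiber, diracRadius]
  split_ifs with h
  · simp
  · rw [hσ.sum_smul_mul_self, EuclideanSpace.norm_eq, Real.sq_sqrt (by positivity)]
    simp [shiftedVec_apply]

theorem phaseFiber_eq (hσ : IsCliffordRep σ) (x₀ : Fin d → ℝ) (x : Lat d) :
    phaseFiber σ x₀ x = (((diracRadius x₀ x)⁻¹ : ℝ) : ℂ) • diracFiber σ x₀ x :=
  mul_inv_abs_of_sq (diracRadius_pos x₀ x) (diracFiber_conjTranspose hσ x₀ x)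
    (diracFiber_mul_self hσ x₀ x)

theorem phaseFiber_conjTranspose (hσ : IsCliffordRep σ) (x₀ : Fin d → ℝ) (x : Lat d) :
    (phaseFiber σ x₀ x).conjTranspose = phaseFiber σ x₀ x := by
  rw [phaseFiber_eq hσ, Matrix.conjTranspose_smul, diracFiber_conjTranspose hσ, Complex.star_def,
    Complex.conj_ofReal]

theorem phaseFiber_mul_self (hσ : IsCliffordRep σ) (x₀ : Fin d → ℝ) (x : Lat d) :
    phaseFiber σ x₀ x * phaseFiber σ x₀ x = 1 := by
  have h : (diracRadius x₀ x : ℂ) ≠ 0 := by exact_mod_cast (diracRadius_pos x₀ x).ne'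
  rw [phaseFiber_eq hσ, smul_mul_smul_comm, diracFiber_mul_self hσ, smul_smul]
  push_cast
  rw [show (diracRadius x₀ x : ℂ)⁻¹ * (diracRadius x₀ x : ℂ)⁻¹ * (diracRadius x₀ x : ℂ) ^ 2 = 1 by
    field_simp, one_smul]

/-- A self-adjoint involution is unitary, so its rows are unit vectors. This serves both the Dirac
phase and the generators `σ k`. -/
theorem norm_apply_le_one_of_mul_self {n : Type*} [Fintype n] [DecidableEq n] {A : Matrix n n ℂ}
    (h1 : A.conjTranspose = A) (h2 : A * A = 1) (i j : n) : ‖A i j‖ ≤ 1 := by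
  have h : ∑ l, ‖A i l‖ ^ 2 = 1 := by
    have h3 : (A * A.conjTranspose) i i = 1 := by rw [h1, h2, Matrix.one_apply_eq]
    rw [Matrix.mul_apply] at h3
    have h4 : ((∑ l, ‖A i l‖ ^ 2 : ℝ) : ℂ) = 1 := by
      rw [← h3]
      push_cast
      refine Finset.sum_congr rfl fun l _ => ?_
      rw [Matrix.conjTranspose_apply, Complex.star_def, Complex.mul_conj, Complex.normSq_eq_norm_sq]
      push_cast
      rfl
    exact_mod_cast h4
  have h5 : ‖A i j‖ ^ 2 ≤ 1 := by
    rw [← h]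
    exact Finset.single_le_sum (f := fun l => ‖A i l‖ ^ 2) (fun _ _ => by positivity)
      (Finset.mem_univ j)
  exact (sq_le_one_iff₀ (norm_nonneg _)).1 h5

theorem norm_phaseFiber_le (hσ : IsCliffordRep σ) (x₀ : Fin d → ℝ) (x : Lat d)
    (i j : Fin (spinDim d)) : ‖phaseFiber σ x₀ x i j‖ ≤ 1 :=
  norm_apply_le_one_of_mul_self (phaseFiber_conjTranspose hσ x₀ x) (phaseFiber_mul_self hσ x₀ x) i j

theorem IsCliffordRep.norm_apply_le (hσ : IsCliffordRep σ) (k : Fin d) (i j : Fin (spinDim d)) :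
    ‖σ k i j‖ ≤ 1 := by
  refine norm_apply_le_one_of_mul_self (hσ.selfAdjoint k) ?_ i j
  have h := hσ.anticomm k k
  rw [if_pos rfl, ← two_smul ℂ, ← one_add_one_eq_two (R := Matrix _ _ ℂ), ← two_smul ℂ] at h
  exact smul_right_injective _ (two_ne_zero' ℂ) h

/-- The Dirac phase varies slowly at infinity. -/
theorem norm_phaseFiber_sub_le (hσ : IsCliffordRep σ) {x₀ : Fin d → ℝ} (hx₀ : x₀ ∈ unitCube d)
    (x y : Lat d) (i j : Fin (spinDim d)) :
    ‖phaseFiber σ x₀ x i j - phaseFiber σ x₀ y i j‖ ≤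
      8 * (d + 1) * (1 + latNorm (y - x)) / (1 + latNorm x) := by
  have hx := latNorm_nonneg x
  have hyx := latNorm_nonneg (y - x)
  have hd : (0 : ℝ) ≤ d := by positivity
  have htriv : ‖phaseFiber σ x₀ x i j - phaseFiber σ x₀ y i j‖ ≤ 2 := by
    refine (norm_sub_le _ _).trans ?_
    linarith [norm_phaseFiber_le hσ x₀ x i j, norm_phaseFiber_le hσ x₀ y i j]
  rw [le_div_iff₀ (by linarith)]
  -- Near the origin the trivial bound 2 is enough. Beyond `2d+1` the shift by `x₀`, of length at
  -- most `d`, leaves `|x+x₀| ≥ (1+|x|)/4`.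
  rcases le_or_gt (latNorm x) (2 * d + 1) with hsmall | hlarge
  · calc _ ≤ 2 * (1 + (2 * d + 1) : ℝ) := by gcongr
      _ ≤ _ := by nlinarith
  have hv : (1 + latNorm x) / 4 ≤ ‖shiftedVec x₀ x‖ := by
    have := latNorm_le_norm_shiftedVec hx₀ x
    linarith
  have hv0 : shiftedVec x₀ x ≠ 0 := norm_pos_iff.1 (lt_of_lt_of_le (by linarith) hv)
  -- At the zero mode the phase is the identity and not a normalised vector, but then `|y-x| =
  -- |x+x₀|` is comparable to `1+|x|` and the trivial bound is again enough.
  by_cases hw0 : shiftedVec x₀ y = 0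
  · have h1 := norm_shiftedVec_sub x₀ x y
    rw [hw0, sub_zero] at h1
    calc _ ≤ 2 * (1 + latNorm x) := by gcongr
      _ ≤ 2 * (4 * latNorm (y - x)) := by linarith
      _ ≤ _ := by nlinarith
  have hF : ∀ z, shiftedVec x₀ z ≠ 0 → phaseFiber σ x₀ z i j =
      ∑ k, (((‖shiftedVec x₀ z‖⁻¹ • shiftedVec x₀ z) k : ℝ) : ℂ) * σ k i j := by
    intro z hz
    have hz' := mt (shiftedVec_eq_zero_iff x₀ z).2 hz
    rw [phaseFiber_eq hσ, diracRadius, diracFiber, if_neg hz', if_neg hz', Matrix.smul_apply,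
      Matrix.sum_apply, Finset.smul_sum]
    refine Finset.sum_congr rfl fun k _ => ?_
    simp [shiftedVec_apply, mul_assoc]
  -- Each of the `d` coordinates of the unit vectors contributes at most the distance between them,
  -- as the entries of `σ k` have modulus at most one.
  have key : ‖phaseFiber σ x₀ x i j - phaseFiber σ x₀ y i j‖ ≤
      d * (2 * latNorm (y - x) / ‖shiftedVec x₀ x‖) := by
    rw [hF x hv0, hF y hw0, ← Finset.sum_sub_distrib]
    refine (norm_sum_le _ _).trans ?_
    rw [← norm_shiftedVec_sub x₀]
    calc _ ≤ ∑ _k : Fin d, 2 * ‖shiftedVec x₀ x - shiftedVec x₀ y‖ / ‖shiftedVec x₀ x‖ := by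
          refine Finset.sum_le_sum fun k _ => ?_
          rw [← sub_mul, norm_mul]
          refine le_trans (mul_le_of_le_one_right (norm_nonneg _) (hσ.norm_apply_le k i j)) ?_
          refine le_trans ?_ (norm_normalize_sub_le hv0 hw0)
          rw [← Complex.ofReal_sub, Complex.norm_real]
          exact PiLp.norm_apply_le
            (‖shiftedVec x₀ x‖⁻¹ • shiftedVec x₀ x - ‖shiftedVec x₀ y‖⁻¹ • shiftedVec x₀ y) k
      _ = _ := by simp
  calc _ ≤ (d * (2 * latNorm (y - x) / ‖shiftedVec x₀ x‖)) * (4 * ‖shiftedVec x₀ x‖) := by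
        gcongr
        linarith
    _ = 8 * d * latNorm (y - x) := by
        have := norm_ne_zero_iff.2 hv0
        field_simp
        ring
    _ ≤ _ := by nlinarith

theorem measurable_phaseFiber (hσ : IsCliffordRep σ) (x : Lat d) (i j : Fin (spinDim d)) :
    Measurable fun x₀ : Fin d → ℝ => phaseFiber σ x₀ x i j := by
  classical
  have hset : MeasurableSet {x₀ : Fin d → ℝ | ∀ k, (x k : ℝ) + x₀ k = 0} := by
    rw [Set.ofPred_forall]
    exact MeasurableSet.iInter fun k =>
      measurableSet_eq_fun (by fun_prop) measurable_const
  have h1 : Measurable fun x₀ : Fin d → ℝ => diracRadius x₀ x := by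
    unfold diracRadius
    refine Measurable.ite hset measurable_const ?_
    simp only [EuclideanSpace.norm_eq, shiftedVec_apply]
    fun_prop
  have h2 : Measurable fun x₀ : Fin d → ℝ => diracFiber σ x₀ x i j := by
    have : (fun x₀ : Fin d → ℝ => diracFiber σ x₀ x i j) = fun x₀ =>
        if ∀ k, (x k : ℝ) + x₀ k = 0 then (1 : Matrix _ _ ℂ) i j
        else ∑ k, (((x k : ℝ) + x₀ k : ℝ) : ℂ) * σ k i j := by
      ext x₀
      rw [diracFiber]
      split_ifs
      · rfl
      · simp [Matrix.sum_apply]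
    rw [this]
    refine Measurable.ite hset measurable_const ?_
    fun_prop
  simp only [phaseFiber_eq hσ, Matrix.smul_apply, smul_eq_mul]
  exact (Complex.measurable_ofReal.comp h1.inv).mul h2

variable (N : ℕ)

theorem spinFiber_injective (x : Lat d) (n : Fin N) :
    Function.Injective fun l : Fin (spinDim d) => ((x, n, l) : SpinSite d N) := by
  intro a b h
  simpa using h

/-- Schur test: a row or column has at most `spinDim d` nonzero entries, each of modulus at most
one. -/
theorem hasKernel_diracPhase (hσ : IsCliffordRep σ) (x₀ : Fin d → ℝ) :
    HasKernel (diracPhase σ x₀ N) (phaseKernel σ x₀ N) := by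
  have key : ∀ (p : SpinSite d N) (g : SpinSite d N → ℂ), (∀ q, ‖g q‖ ≤ 1) →
      (∀ q : SpinSite d N, ¬ (p.1 = q.1 ∧ p.2.1 = q.2.1) → g q = 0) →
      ∑' q, ‖g q‖ₑ ≤ ENNReal.ofReal (spinDim d) := by
    intro p g hg hg0
    rw [← (spinFiber_injective N p.1 p.2.1).tsum_eq]
    · rw [tsum_fintype]
      calc _ ≤ ∑ _l : Fin (spinDim d), (1 : ℝ≥0∞) := by
            refine Finset.sum_le_sum fun l _ => ?_
            rw [← ofReal_norm]
            exact ENNReal.ofReal_le_one.2 (hg _)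
        _ = _ := by simp
    · intro q hq
      have hq' : g q ≠ 0 := by simpa using hq
      have := not_imp_comm.1 (hg0 q) hq'
      exact ⟨q.2.2, by rw [this.1, this.2]⟩
  have hle : ∀ p q, ‖phaseKernel σ x₀ N p q‖ ≤ 1 := by
    intro p q
    rw [phaseKernel]
    split_ifs
    · exact norm_phaseFiber_le hσ _ _ _ _
    · simp
  obtain ⟨T, hT, -⟩ := exists_hasKernel_of_schur (K := phaseKernel σ x₀ N)
    (C := spinDim d) (by positivity)
    (fun p => key p _ (fun q => hle p q) fun q hq => if_neg hq)
    (fun q => key q _ (fun p => hle p q) fun p hp => if_neg fun h => hp ⟨h.1.symm, h.2.symm⟩)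
  exact hT.kernelOp

theorem diracPhase_adjoint (hσ : IsCliffordRep σ) (x₀ : Fin d → ℝ) :
    ContinuousLinearMap.adjoint (diracPhase σ x₀ N) = diracPhase σ x₀ N := by
  have hk := hasKernel_diracPhase N hσ x₀
  refine HasKernel.unique (hasKernel_iff.2 fun p q => ?_) hk
  rw [entry_adjoint, ← hk.eq_entry, phaseKernel, phaseKernel]
  by_cases h : p.1 = q.1 ∧ p.2.1 = q.2.1
  · rw [if_pos h, if_pos ⟨h.1.symm, h.2.symm⟩, h.1]
    exact congrFun (congrFun (phaseFiber_conjTranspose hσ x₀ q.1) p.2.2) q.2.2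
  · rw [if_neg h, if_neg fun h' => h ⟨h'.1.symm, h'.2.symm⟩, star_zero]

theorem hasSum_phaseKernel_mul (x₀ : Fin d → ℝ) (p : SpinSite d N) (g : SpinSite d N → ℂ) :
    HasSum (fun r => phaseKernel σ x₀ N p r * g r)
      (∑ l, phaseFiber σ x₀ p.1 p.2.2 l * g (p.1, p.2.1, l)) := by
  rw [← (spinFiber_injective N p.1 p.2.1).hasSum_iff]
  · convert hasSum_fintype _ using 2
    simp [phaseKernel]
  · intro r hr
    rw [phaseKernel, if_neg, zero_mul]
    exact fun h => hr ⟨r.2.2, by rw [h.1, h.2]⟩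

theorem hasSum_mul_phaseKernel (x₀ : Fin d → ℝ) (q : SpinSite d N) (g : SpinSite d N → ℂ) :
    HasSum (fun r => g r * phaseKernel σ x₀ N r q)
      (∑ l, g (q.1, q.2.1, l) * phaseFiber σ x₀ q.1 l q.2.2) := by
  rw [← (spinFiber_injective N q.1 q.2.1).hasSum_iff]
  · convert hasSum_fintype _ using 2
    simp [phaseKernel]
  · intro r hr
    rw [phaseKernel, if_neg, mul_zero]
    exact fun h => hr ⟨r.2.2, by rw [← h.1, ← h.2]⟩

theorem diracPhase_mul_self (hσ : IsCliffordRep σ) (x₀ : Fin d → ℝ) :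
    diracPhase σ x₀ N * diracPhase σ x₀ N = 1 := by
  have hk := hasKernel_diracPhase N hσ x₀
  refine HasKernel.unique (hk.mul hk fun p q => hasSum_phaseKernel_mul N x₀ p _)
    (hasKernel_iff.2 fun p q => ?_)
  rw [entry_one]
  have h2 := congrFun (congrFun (phaseFiber_mul_self hσ x₀ p.1) p.2.2) q.2.2
  rw [Matrix.mul_apply] at h2
  obtain ⟨x, n, i⟩ := p
  obtain ⟨y, m, j⟩ := q
  by_cases h : x = y ∧ n = m
  · obtain ⟨rfl, rfl⟩ := h
    simp only [phaseKernel, and_self, if_true]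
    rw [h2, Matrix.one_apply]
    simp
  · simp only [phaseKernel, h, if_false, mul_zero, Finset.sum_const_zero]
    rw [if_neg]
    intro h'
    simp only [Prod.mk.injEq] at h'
    exact h ⟨h'.1, h'.2.1⟩

end DiracPhase

/-! ### The representation on `ℓ²` -/

section Representation

variable {d N : ℕ}

theorem norm_phase (B : MagneticForm d) (x y : Lat d) : ‖B.phase x y‖ = 1 := by
  rw [MagneticForm.phase, mul_comm, Complex.norm_exp_ofReal_mul_I]

theorem phase_ne_zero (B : MagneticForm d) (x y : Lat d) : B.phase x y ≠ 0 := Complex.exp_ne_zero _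

/-- The cocycle identity behind multiplicativity of `π_ω`: both sides have the exponent `y∧x + y∧z +
z∧x`. -/
theorem phase_mul_phase (B : MagneticForm d) (x y z : Lat d) :
    B.phase (z + x) x * B.phase y (z + x) = B.phase y x * B.phase (y - x) z := by
  simp only [MagneticForm.phase, ← Complex.exp_add]
  congr 1
  have h0 : B.form x x = 0 := by linarith [B.antisymm x x]
  have h1 := B.antisymm z x
  simp only [map_add, map_sub, AddMonoidHom.sub_apply, AddMonoidHom.add_apply, h0, h1]
  push_cast
  ring

theorem tsum_shift_right {β : Type*} [Fintype β] (h : Lat d → ℝ≥0∞) (x : Lat d) :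
    ∑' q : Lat d × β, h (q.1 - x) = Fintype.card β * ∑' z, h z := by
  rw [ENNReal.tsum_prod' (f := fun q : Lat d × β => h (q.1 - x)),
    ← (Equiv.subRight x).tsum_eq h, ← ENNReal.tsum_mul_left]
  refine tsum_congr fun y => ?_
  simp [tsum_fintype]

theorem tsum_shift_left {β : Type*} [Fintype β] (h : Lat d → ℝ≥0∞) (y : Lat d) :
    ∑' q : Lat d × β, h (y - q.1) = Fintype.card β * ∑' z, h z := by
  rw [ENNReal.tsum_prod' (f := fun q : Lat d × β => h (y - q.1)),
    ← (Equiv.subLeft y).tsum_eq h, ← ENNReal.tsum_mul_left]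
  refine tsum_congr fun y => ?_
  simp [tsum_fintype]

/-- The sites with a given spin component. -/
def spinInsert (l : Fin (spinDim d)) (r : Site d N) : SpinSite d N := (r.1, r.2, l)

theorem spinInsert_injective (l : Fin (spinDim d)) :
    Function.Injective (spinInsert (N := N) l) := by
  rintro ⟨a, b⟩ ⟨a', b'⟩ h
  simpa [spinInsert] using h

theorem mem_range_spinInsert {l : Fin (spinDim d)} {r : SpinSite d N} (h : r.2.2 = l) :
    r ∈ Set.range (spinInsert (N := N) l) :=
  ⟨(r.1, r.2.1), by rw [← h]; rfl⟩

theorem tsum_spinSite (h : SpinSite d N → ℝ≥0∞) :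
    ∑' p, h p = ∑ l, ∑' r, h (spinInsert l r) := by
  rw [← (Equiv.prodAssoc (Lat d) (Fin N) (Fin (spinDim d))).tsum_eq h, ENNReal.tsum_prod',
    ENNReal.tsum_comm, tsum_fintype]
  rfl

variable {Ω : Type*} [AddAction (Lat d) Ω] {B : MagneticForm d} {ω : Ω} {f g : Obs Ω d N}

/-- A bounded operator `π_ω(f)` on `ℓ²(ℤ^d, ℂ^N)` extends to `π_ω(f) ⊗ id` on `ℋ`. -/
theorem hasKernel_spinOp {T : ℓ²(Site d N, ℂ) →L[ℂ] ℓ²(Site d N, ℂ)}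
    (hT : HasKernel T (piKernel B ω f)) : HasKernel (spinOp B ω f) (spinKernel B ω f) := by
  have hm : ∀ (ψ : SpinSpace d N) l, Memℓp (fun r => ψ (spinInsert l r)) 2 := by
    intro ψ l
    refine memℓp_two_of_tsum_ne_top (ne_top_of_le_ne_top (b := ‖ψ‖ₑ ^ 2) (by simp) ?_)
    rw [enorm_sq_eq_tsum]
    exact ENNReal.tsum_comp_le_tsum_of_injective (spinInsert_injective l) (fun q => ‖ψ q‖ₑ ^ 2)
  let R : SpinSpace d N → Fin (spinDim d) → ℓ²(Site d N, ℂ) := fun ψ l => ⟨_, hm ψ l⟩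
  have hsum : ∀ (ψ : SpinSpace d N) p, HasSum (fun q => spinKernel B ω f p q * ψ q)
      (T (R ψ p.2.2) (p.1, p.2.1)) := by
    intro ψ p
    rw [← (spinInsert_injective p.2.2).hasSum_iff]
    · convert hT (R ψ p.2.2) (p.1, p.2.1) using 2 with r
      simp [spinKernel, spinInsert, R]
    · intro q hq
      rw [spinKernel, if_neg fun h => hq (mem_range_spinInsert h.symm), zero_mul]
  -- The squared norm on `ℋ` splits over spin components and `T` acts on each one, so the bound
  -- `‖T‖` is inherited.
  obtain ⟨S, hS, -⟩ := exists_hasKernel (K := spinKernel B ω f) (norm_nonneg T)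
    (fun ψ p => (hsum ψ p).summable) (fun ψ => by
      simp only [fun p => (hsum ψ p).tsum_eq]
      rw [tsum_spinSite, enorm_sq_eq_tsum ψ, tsum_spinSite, Finset.mul_sum]
      refine Finset.sum_le_sum fun l _ => ?_
      change ∑' r : Site d N, ‖T (R ψ l) r‖ₑ ^ 2 ≤ _ * ∑' r, ‖R ψ l r‖ₑ ^ 2
      rw [← enorm_sq_eq_tsum, ← enorm_sq_eq_tsum, ← mul_pow]
      refine pow_le_pow_left₀ (by simp) ?_ 2
      rw [ofReal_norm]
      exact T.le_opENorm _)
  exact hS.kernelOp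

/-- The kernel of a product is the kernel of the twisted convolution. -/
theorem hasSum_piKernel_conv {T S : ℓ²(Site d N, ℂ) →L[ℂ] ℓ²(Site d N, ℂ)}
    (hT : HasKernel T (piKernel B ω f)) (hS : HasKernel S (piKernel B ω g)) (p q : Site d N) :
    HasSum (fun r => piKernel B ω f p r * piKernel B ω g r q) (piKernel B ω (conv B f g) p q) := by
  obtain ⟨x, n⟩ := p
  obtain ⟨y, m⟩ := q
  let M : Lat d → Mat N := fun z =>
    B.phase (y - x) z • (f (-x +ᵥ ω) z * g (-z +ᵥ (-x +ᵥ ω)) (y - x - z))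
  have hTS : ∀ n m, HasSum
      (fun r => piKernel B ω f (x, n) r * piKernel B ω g r (y, m)) (entry (T * S) (x, n) (y, m)) := by
    intro n m
    rw [hT.eq_entry, hS.eq_entry]
    exact hasSum_entry_mul T S _ _
  -- Sum over the internal index first, then shift the intermediate site by `x`; the result is the
  -- convolution series up to the phase.
  have h1 : ∀ n m, HasSum (fun z => B.phase y x * M z n m) (entry (T * S) (x, n) (y, m)) := by
    intro n m
    have h2 := (hTS n m).prod_fiberwise fun z => hasSum_fintype _
    rw [← (Equiv.addRight x).hasSum_iff] at h2
    convert h2 using 2 with z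
    simp only [M, Function.comp_apply, Equiv.coe_addRight, piKernel, Matrix.smul_apply,
      Matrix.mul_apply, smul_eq_mul, Finset.mul_sum]
    refine Finset.sum_congr rfl fun l _ => ?_
    rw [add_sub_cancel_right, vadd_vadd, show -z + -x = -(z + x) by abel,
      show y - x - z = y - (z + x) by abel, ← mul_assoc, ← phase_mul_phase]
    ring
  -- `conv` is a `tsum`, with default value zero on divergent series. Summability is read off from
  -- the convergent operator product after cancelling the nonzero phase.
  have hsum : HasSum M (∑' z, M z) := by
    refine Summable.hasSum (Pi.summable.2 fun n => Pi.summable.2 fun m => ?_)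
    have := (h1 n m).summable
    exact (summable_mul_left_iff (phase_ne_zero B y x)).1 this
  have h3 : HasSum (fun z => B.phase y x * M z n m) (piKernel B ω (conv B f g) (x, n) (y, m)) :=
    (Pi.hasSum.1 (Pi.hasSum.1 hsum n) m).mul_left _
  rw [← (h1 n m).unique h3]
  exact hTS n m

theorem hasSum_spinKernel_conv {T S : ℓ²(Site d N, ℂ) →L[ℂ] ℓ²(Site d N, ℂ)}
    (hT : HasKernel T (piKernel B ω f)) (hS : HasKernel S (piKernel B ω g)) (p q : SpinSite d N) :
    HasSum (fun r => spinKernel B ω f p r * spinKernel B ω g r q)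
      (spinKernel B ω (conv B f g) p q) := by
  rw [← (spinInsert_injective p.2.2).hasSum_iff]
  · by_cases h : p.2.2 = q.2.2
    · convert hasSum_piKernel_conv hT hS (p.1, p.2.1) (q.1, q.2.1) using 2 with r
      · simp [spinKernel, spinInsert, h]
      · simp [spinKernel, h]
    · convert hasSum_zero using 2 with r
      · simp [spinKernel, spinInsert, h]
      · simp [spinKernel, h]
  · intro r hr
    rw [spinKernel, if_neg fun h => hr (mem_range_spinInsert h.symm), zero_mul]

theorem piKernel_add (p q : Site d N) :
    piKernel B ω (f + g) p q = piKernel B ω f p q + piKernel B ω g p q := by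
  simp [piKernel, mul_add]

theorem piKernel_smul (c : ℂ) (p q : Site d N) :
    piKernel B ω (c • f) p q = c * piKernel B ω f p q := by
  simp only [piKernel, Pi.smul_apply, Matrix.smul_apply, smul_eq_mul]
  ring

theorem piKernel_invol (p q : Site d N) :
    piKernel B ω (invol f) p q = star (piKernel B ω f q p) := by
  simp only [piKernel, invol, Matrix.conjTranspose_apply, star_mul', CompactObs.star_phase,
    vadd_vadd]
  rw [show -(q.1 - p.1) + -p.1 = -q.1 by abel, neg_sub]

theorem piKernel_unitObs (p q : Site d N) :
    piKernel B ω (unitObs : Obs Ω d N) p q = if p = q then 1 else 0 := by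
  obtain ⟨x, n⟩ := p
  obtain ⟨y, m⟩ := q
  by_cases h : x = y
  · subst h
    simp [piKernel, unitObs, CompactObs.phase_self, Matrix.one_apply]
  · have h' : y - x ≠ 0 := fun h0 => h (sub_eq_zero.1 h0).symm
    simp [piKernel, unitObs, h, h']

/-! ### Compatibility with the `*`-algebra operations -/

section Homomorphism

variable {T S : ℓ²(Site d N, ℂ) →L[ℂ] ℓ²(Site d N, ℂ)}

theorem HasKernel.piKernel_add (hT : HasKernel T (piKernel B ω f))
    (hS : HasKernel S (piKernel B ω g)) : HasKernel (T + S) (piKernel B ω (f + g)) :=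
  hasKernel_iff.2 fun p q => by
    rw [entry_add, OddChern.piKernel_add, ← hT.eq_entry, ← hS.eq_entry]

theorem HasKernel.piKernel_smul (c : ℂ) (hT : HasKernel T (piKernel B ω f)) :
    HasKernel (c • T) (piKernel B ω (c • f)) :=
  hasKernel_iff.2 fun p q => by rw [entry_smul, OddChern.piKernel_smul, ← hT.eq_entry]

theorem HasKernel.piKernel_invol (hT : HasKernel T (piKernel B ω f)) :
    HasKernel (ContinuousLinearMap.adjoint T) (piKernel B ω (invol f)) :=
  hasKernel_iff.2 fun p q => by rw [entry_adjoint, OddChern.piKernel_invol, ← hT.eq_entry]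

theorem HasKernel.piKernel_conv (hT : HasKernel T (piKernel B ω f))
    (hS : HasKernel S (piKernel B ω g)) : HasKernel (T * S) (piKernel B ω (conv B f g)) :=
  hT.mul hS (hasSum_piKernel_conv hT hS)

theorem spinOp_unitObs : spinOp B ω (unitObs : Obs Ω d N) = 1 := by
  refine HasKernel.kernelOp_eq (hasKernel_iff.2 fun p q => ?_)
  rw [entry_one, spinKernel, piKernel_unitObs]
  obtain ⟨x, n, i⟩ := p
  obtain ⟨y, m, j⟩ := q
  simp only [Prod.mk.injEq]
  split_ifs <;> tauto

theorem spinOp_add (hT : HasKernel T (piKernel B ω f)) (hS : HasKernel S (piKernel B ω g)) :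
    spinOp B ω (f + g) = spinOp B ω f + spinOp B ω g := by
  refine HasKernel.kernelOp_eq (hasKernel_iff.2 fun p q => ?_)
  rw [entry_add, ← (hasKernel_spinOp hT).eq_entry, ← (hasKernel_spinOp hS).eq_entry]
  simp only [spinKernel, piKernel_add]
  split_ifs <;> simp

theorem spinOp_smul (c : ℂ) (hT : HasKernel T (piKernel B ω f)) :
    spinOp B ω (c • f) = c • spinOp B ω f := by
  refine HasKernel.kernelOp_eq (hasKernel_iff.2 fun p q => ?_)
  rw [entry_smul, ← (hasKernel_spinOp hT).eq_entry]
  simp only [spinKernel, piKernel_smul]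
  split_ifs <;> simp

theorem spinOp_conv (hT : HasKernel T (piKernel B ω f)) (hS : HasKernel S (piKernel B ω g)) :
    spinOp B ω (conv B f g) = spinOp B ω f * spinOp B ω g :=
  ((hasKernel_spinOp hT).mul (hasKernel_spinOp hS) (hasSum_spinKernel_conv hT hS)).kernelOp_eq

theorem spinOp_invol (hT : HasKernel T (piKernel B ω f)) :
    spinOp B ω (invol f) = ContinuousLinearMap.adjoint (spinOp B ω f) := by
  refine HasKernel.kernelOp_eq (hasKernel_iff.2 fun p q => ?_)
  rw [entry_adjoint, ← (hasKernel_spinOp hT).eq_entry]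
  simp only [spinKernel, piKernel_invol, eq_comm (a := q.2.2)]
  split_ifs <;> simp

end Homomorphism

/-- The kernel of the commutator with the Dirac phase. -/
theorem hasKernel_commutator {σ : Fin d → Matrix (Fin (spinDim d)) (Fin (spinDim d)) ℂ}
    (hσ : IsCliffordRep σ) (x₀ : Fin d → ℝ)
    (hf : HasKernel (spinOp B ω f) (spinKernel B ω f)) :
    HasKernel (diracPhase σ x₀ N * spinOp B ω f - spinOp B ω f * diracPhase σ x₀ N)
      fun p q => (phaseFiber σ x₀ p.1 p.2.2 q.2.2 - phaseFiber σ x₀ q.1 p.2.2 q.2.2) *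
        piKernel B ω f (p.1, p.2.1) (q.1, q.2.1) := by
  have hF := hasKernel_diracPhase N hσ x₀
  refine hasKernel_iff.2 fun p q => ?_
  rw [entry_sub,
    ← (hF.mul hf fun p q => hasSum_phaseKernel_mul N x₀ p fun r => spinKernel B ω f r q).eq_entry,
    ← (hf.mul hF fun p q => hasSum_mul_phaseKernel N x₀ q fun r => spinKernel B ω f p r).eq_entry]
  simp only [spinKernel, mul_ite, mul_zero, ite_mul, zero_mul, Finset.sum_ite_eq,
    Finset.sum_ite_eq', Finset.mem_univ, if_true]
  ring

/-- Bounded finite range observables act as bounded operators. -/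
theorem exists_hasKernel_piKernel {c : ℝ} (hc : 0 ≤ c) {s : Finset (Lat d)}
    (hf : ∀ ω x n m, ‖f ω x n m‖ ≤ c) (hs : ∀ x, x ∉ s → ∀ ω, f ω x = 0) (ω : Ω) :
    ∃ T : ℓ²(Site d N, ℂ) →L[ℂ] ℓ²(Site d N, ℂ), HasKernel T (piKernel B ω f) ∧
      ‖T‖ ≤ N * (s.card * c) := by
  classical
  let h : Lat d → ℝ≥0∞ := fun z => if z ∈ s then ENNReal.ofReal c else 0
  have hle : ∀ p q, ‖piKernel B ω f p q‖ₑ ≤ h (q.1 - p.1) := by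
    intro p q
    rw [← ofReal_norm, piKernel, norm_mul, norm_phase, one_mul]
    simp only [h]
    split_ifs with hz
    · exact ENNReal.ofReal_le_ofReal (hf _ _ _ _)
    · simp [hs _ hz]
  have hsum : ∑' z, h z = s.card * ENNReal.ofReal c := by
    rw [tsum_eq_sum (s := s) fun z hz => if_neg hz, Finset.sum_congr rfl fun z hz => if_pos hz]
    simp
  have hC : (Fintype.card (Fin N) : ℝ≥0∞) * ∑' z, h z = ENNReal.ofReal (N * (s.card * c)) := by
    rw [hsum, Fintype.card_fin, ENNReal.ofReal_mul (by positivity),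
      ENNReal.ofReal_mul (by positivity), ENNReal.ofReal_natCast, ENNReal.ofReal_natCast]
  refine exists_hasKernel_of_schur (by positivity) (fun p => ?_) fun q => ?_
  · rw [← hC, ← tsum_shift_right h p.1]
    exact ENNReal.tsum_le_tsum fun q => hle p q
  · rw [← hC, ← tsum_shift_left h q.1]
    exact ENNReal.tsum_le_tsum fun p => hle p q

/-- The values `f ω x` form the row of the kernel at the origin, where the phase is trivial. -/
theorem norm_obs_le {ω : Ω} {T : ℓ²(Site d N, ℂ) →L[ℂ] ℓ²(Site d N, ℂ)}
    (hT : HasKernel T (piKernel B ω f)) (x : Lat d) (n m : Fin N) : ‖f ω x n m‖ ≤ ‖T‖ := by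
  have h := norm_entry_le T (0, n) (x, m)
  rw [← hT.eq_entry] at h
  simpa [piKernel, norm_phase] using h

theorem conv_apply_eq_piKernel (ω : Ω) (x : Lat d) (n m : Fin N) :
    conv B f g ω x n m = piKernel B ω (conv B f g) (0, n) (x, m) := by
  simp [piKernel, CompactObs.phase_zero_right]

end Representation

/-! ### Bounds for compactly supported observables -/

section Compact

variable {Ω : Type*} [TopologicalSpace Ω] {d N : ℕ} {B : MagneticForm d}

theorem CompactObs.exists_bound (f : CompactObs Ω B N) :
    ∃ c : ℝ, 0 ≤ c ∧ ∀ ω x n m, ‖f.val ω x n m‖ ≤ c := by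
  have h : ∀ n m, ∃ c, ∀ q : Ω × Lat d, ‖f.val q.1 q.2 n m‖ ≤ c := by
    intro n m
    have hcont : Continuous fun q : Ω × Lat d => f.val q.1 q.2 n m :=
      ((CompactlySupportedContinuousMap.toContinuousMap f).continuous).matrix_elem n m
    have hsupp : HasCompactSupport fun q : Ω × Lat d => f.val q.1 q.2 n m :=
      HasCompactSupport.comp_left (g := fun A : Mat N => A n m) f.hasCompactSupport' rfl
    exact hsupp.exists_bound_of_continuous hcont
  choose c hc using h
  refine ⟨∑ n, ∑ m, |c n m|, by positivity, fun ω x n m => ?_⟩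
  refine (hc n m (ω, x)).trans ((le_abs_self _).trans ?_)
  refine le_trans ?_ (Finset.single_le_sum (f := fun n => ∑ m, |c n m|)
    (fun _ _ => by positivity) (Finset.mem_univ n))
  exact Finset.single_le_sum (f := fun m => |c n m|) (fun _ _ => by positivity) (Finset.mem_univ m)

variable [AddAction (Lat d) Ω]

/-- Bounded entries and finite range pass the Schur test with a constant independent of `ω`, so no
null set has to be removed on `𝒜₀`. -/
theorem CompactObs.exists_hasKernel (f : CompactObs Ω B N) :
    ∃ C : ℝ, ∀ ω, ∃ T : ℓ²(Site d N, ℂ) →L[ℂ] ℓ²(Site d N, ℂ),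
      HasKernel T (piKernel B ω f.val) ∧ ‖T‖ ≤ C := by
  obtain ⟨c, hc, hfc⟩ := f.exists_bound
  obtain ⟨s, hs⟩ := f.exists_finset
  exact ⟨_, fun ω => exists_hasKernel_piKernel hc hfc hs ω⟩

end Compact

/-! ### Lattice sums -/

section LatticeSums

variable {d : ℕ}

/-- Comparison with the lattice sum of `‖x‖^{-(d+1)}`, which converges because `d+1` exceeds the
rank. This fixes the summability exponent. -/
theorem summable_one_add_latNorm_inv_pow :
    Summable fun x : Lat d => ((1 + latNorm x)⁻¹) ^ (d + 1) := by
  classical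
  let b := (EuclideanSpace.basisFun (Fin d) ℝ).toBasis
  let L := Submodule.span ℤ (Set.range b)
  have hrank : Module.finrank ℤ L < d + 1 := by
    rw [ZLattice.rank ℝ L, finrank_euclideanSpace_fin]
    exact Nat.lt_succ_self d
  have hL := ZLattice.summable_norm_pow_inv L (d + 1) hrank
  have hmem : ∀ x : Lat d, shiftedVec 0 x ∈ L := by
    intro x
    rw [Module.Basis.mem_span_iff_repr_mem]
    intro j
    exact ⟨x j, by simp [b, shiftedVec_apply]⟩
  let e : Lat d → L := fun x => ⟨shiftedVec 0 x, hmem x⟩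
  have he : Function.Injective e := by
    intro x y h
    ext j
    have h1 : shiftedVec 0 x j = shiftedVec 0 y j := by
      rw [show shiftedVec 0 x = shiftedVec 0 y from congrArg Subtype.val h]
    simpa [shiftedVec_apply] using h1
  -- At the origin the lattice summand is zero, since `0⁻¹ = 0`, while the term to be bounded is
  -- one; a single unit term makes up for it.
  have h1 := (hL.comp_injective he).add (hasSum_ite_eq (0 : Lat d) (1 : ℝ)).summable
  refine Summable.of_nonneg_of_le
    (fun x => by have := latNorm_nonneg x; positivity) (fun x => ?_) h1
  have hx := latNorm_nonneg x
  have hex : ‖e x‖ = latNorm x := (latNorm_eq_norm x).symm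
  simp only [Function.comp_apply, hex]
  rcases hx.eq_or_lt with h0 | hpos
  · have hx0 : x = 0 := by
      refine he (Subtype.ext ?_)
      rw [latNorm_eq_norm] at h0
      have h2 := latNorm_zero (d := d)
      rw [latNorm_eq_norm] at h2
      change shiftedVec 0 x = shiftedVec 0 0
      rw [norm_eq_zero.1 h0.symm, norm_eq_zero.1 h2]
    rw [← h0]
    simp [hx0]
  · have h2 : ((1 + latNorm x)⁻¹) ^ (d + 1) ≤ ((latNorm x)⁻¹) ^ (d + 1) := by
      gcongr
      linarith
    split_ifs <;> linarith

theorem tsum_one_add_latNorm_inv_pow_ne_top :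
    ∑' x : Lat d, ENNReal.ofReal ((1 + latNorm x)⁻¹) ^ (d + 1) ≠ ∞ := by
  have h : ∀ x : Lat d, 0 ≤ (1 + latNorm x)⁻¹ := fun x => by
    have := latNorm_nonneg x; positivity
  simp only [← ENNReal.ofReal_pow (h _)]
  rw [← ENNReal.ofReal_tsum_of_nonneg (fun x => pow_nonneg (h x) _)
    summable_one_add_latNorm_inv_pow]
  exact ENNReal.ofReal_ne_top

/-- From `t^n/n! ≤ e^t` with `t = c(1+|x|)` and `n = m+d+1`, the summand is at most a constant times
`(1+|x|)^{-(d+1)}`. -/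
theorem tsum_latNorm_pow_mul_exp_ne_top (m : ℕ) {c : ℝ} (hc : 0 < c) :
    ∑' x : Lat d, ENNReal.ofReal ((1 + latNorm x) ^ m * Real.exp (-c * latNorm x)) ≠ ∞ := by
  have hkey : ∀ x : Lat d, (1 + latNorm x) ^ m * Real.exp (-c * latNorm x) ≤
      ((m + (d + 1)).factorial * Real.exp c / c ^ (m + (d + 1))) *
        ((1 + latNorm x)⁻¹) ^ (d + 1) := by
    intro x
    have hx := latNorm_nonneg x
    have h1 := Real.pow_div_factorial_le_exp (x := c * (1 + latNorm x)) (by positivity)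
      (m + (d + 1))
    rw [div_le_iff₀ (by positivity), mul_pow, mul_add, mul_one, Real.exp_add] at h1
    rw [neg_mul, Real.exp_neg, inv_pow, ← div_eq_mul_inv, ← div_eq_mul_inv, div_div, div_le_div_iff₀
      (by positivity) (by positivity)]
    calc _ = c ^ (m + (d + 1)) * (1 + latNorm x) ^ (m + (d + 1)) := by
          rw [pow_add (1 + latNorm x)]; ring
      _ ≤ _ := h1
      _ = _ := by ring
  refine ne_top_of_le_ne_top ?_ (ENNReal.tsum_le_tsum fun x => ENNReal.ofReal_le_ofReal (hkey x))
  have h0 : 0 ≤ ((m + (d + 1)).factorial * Real.exp c / c ^ (m + (d + 1)) : ℝ) := by positivity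
  have h : ∀ x : Lat d, 0 ≤ (1 + latNorm x)⁻¹ := fun x => by
    have := latNorm_nonneg x; positivity
  simp only [ENNReal.ofReal_mul h0, ENNReal.tsum_mul_left, ENNReal.ofReal_pow (h _)]
  exact ENNReal.mul_ne_top ENNReal.ofReal_ne_top tsum_one_add_latNorm_inv_pow_ne_top

theorem tsum_exp_latNorm_ne_top {c : ℝ} (hc : 0 < c) :
    ∑' x : Lat d, ENNReal.ofReal (Real.exp (-c * latNorm x)) ≠ ∞ := by
  simpa using tsum_latNorm_pow_mul_exp_ne_top (d := d) 0 hc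

end LatticeSums

/-! ### Localized observables -/

section MatrixNorm

variable {N : ℕ}

theorem enorm_apply_le_enorm_toEuclideanCLM (A : Mat N) (n m : Fin N) :
    ‖A n m‖ₑ ≤ ‖Matrix.toEuclideanCLM (𝕜 := ℂ) A‖ₑ := by
  rw [← ofReal_norm, ← ofReal_norm]
  refine ENNReal.ofReal_le_ofReal ?_
  have h1 := (Matrix.toEuclideanCLM (𝕜 := ℂ) A).le_opNorm (EuclideanSpace.single m 1)
  rw [EuclideanSpace.single, PiLp.norm_single, norm_one, mul_one] at h1
  refine le_trans ?_ ((PiLp.norm_apply_le _ n).trans h1)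
  simp [Matrix.ofLp_toEuclideanCLM]

theorem enorm_toEuclideanCLM_le (A : Mat N) :
    ‖Matrix.toEuclideanCLM (𝕜 := ℂ) A‖ₑ ≤ ∑ n, ∑ m, ‖A n m‖ₑ := by
  simp only [← ofReal_norm]
  simp only [← ENNReal.ofReal_sum_of_nonneg (fun _ _ => norm_nonneg _)]
  rw [← ENNReal.ofReal_sum_of_nonneg (fun _ _ => by positivity)]
  refine ENNReal.ofReal_le_ofReal (ContinuousLinearMap.opNorm_le_bound _ (by positivity) fun v => ?_)
  rw [EuclideanSpace.norm_eq]
  refine (Real.sqrt_le_sqrt (Finset.sum_sq_le_sq_sum_of_nonneg fun _ _ => norm_nonneg _)).trans ?_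
  rw [Real.sqrt_sq (by positivity), Finset.sum_mul]
  refine Finset.sum_le_sum fun n _ => ?_
  rw [Matrix.ofLp_toEuclideanCLM, Matrix.mulVec, dotProduct, Finset.sum_mul]
  refine (norm_sum_le _ _).trans (Finset.sum_le_sum fun m _ => ?_)
  rw [norm_mul]
  gcongr
  exact PiLp.norm_apply_le v m

end MatrixNorm

/-- For a countable index set the finite partial sums converge along a countably generated filter,
so the limit inherits measurability. -/
theorem aemeasurable_of_hasSum {α ι : Type*} [MeasurableSpace α] [Countable ι] {μ : Measure α}
    {F : ι → α → ℂ} {G : α → ℂ} (hF : ∀ i, AEMeasurable (F i) μ)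
    (h : ∀ᵐ a ∂μ, HasSum (fun i => F i a) (G a)) : AEMeasurable G μ :=
  aemeasurable_of_tendsto_metrizable_ae Filter.atTop
    (f := fun (s : Finset ι) a => ∑ i ∈ s, F i a)
    (fun s => Finset.aemeasurable_fun_sum s fun i _ => hF i) h

section EntryDecay

variable {Ω : Type*} {d N : ℕ} [MeasurableSpace Ω] {P : Measure Ω} {f g : Obs Ω d N}

/-- Exponential decay of the averaged matrix entries. -/
def EntryDecay (P : Measure Ω) (f : Obs Ω d N) : Prop :=
  ∃ A > 0, ∃ l > 0, ∀ (x : Lat d) (n m : Fin N),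
    ∫⁻ ω, ‖f ω x n m‖ₑ ∂P ≤ ENNReal.ofReal (A * Real.exp (-l * latNorm x))

theorem EntryDecay.mono_rate {A A' l l' : ℝ} (hA' : 0 ≤ A') (hA : A ≤ A') (hl : l' ≤ l) (x : Lat d) :
    ENNReal.ofReal (A * Real.exp (-l * latNorm x)) ≤
      ENNReal.ofReal (A' * Real.exp (-l' * latNorm x)) := by
  have := latNorm_nonneg x
  refine ENNReal.ofReal_le_ofReal ?_
  gcongr

/-- Two decaying observables decay with a common rate. -/
theorem EntryDecay.common (hf : EntryDecay P f) (hg : EntryDecay P g) :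
    ∃ A > 0, ∃ l > 0, (∀ (x : Lat d) (n m : Fin N),
      ∫⁻ ω, ‖f ω x n m‖ₑ ∂P ≤ ENNReal.ofReal (A * Real.exp (-l * latNorm x))) ∧
      ∀ (x : Lat d) (n m : Fin N),
      ∫⁻ ω, ‖g ω x n m‖ₑ ∂P ≤ ENNReal.ofReal (A * Real.exp (-l * latNorm x)) := by
  obtain ⟨A, hA, l, hl, h⟩ := hf
  obtain ⟨A', hA', l', hl', h'⟩ := hg
  exact ⟨max A A', lt_max_of_lt_left hA, min l l', lt_min hl hl',
    fun x n m => (h x n m).trans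
      (mono_rate (le_max_of_le_left hA.le) (le_max_left _ _) (min_le_left _ _) x),
    fun x n m => (h' x n m).trans
      (mono_rate (le_max_of_le_left hA.le) (le_max_right _ _) (min_le_right _ _) x)⟩

end EntryDecay

/-! ### Closure of the localized observables under the algebra operations -/

section Localized

variable {Ω : Type*} {d N : ℕ} [MeasurableSpace Ω] [AddAction (Lat d) Ω] {B : MagneticForm d}
  {P : Measure Ω} {f g : Obs Ω d N}

theorem MemLoc.entryDecay (hf : MemLoc B P f) : EntryDecay P f := by
  obtain ⟨A, hA, l, hl, h⟩ := hf.decay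
  exact ⟨A, hA, l, hl, fun x n m =>
    (lintegral_mono fun ω => enorm_apply_le_enorm_toEuclideanCLM _ n m).trans (h x)⟩

theorem MemLInfty.memLoc (hf : MemLInfty B P f) (h : EntryDecay P f) : MemLoc B P f := by
  obtain ⟨A, hA, l, hl, h⟩ := h
  -- The operator norm is at most the sum of the `N²` entries; the extra one keeps the constant
  -- positive when `N = 0`.
  refine ⟨hf, (N * N + 1) * A, by positivity, l, hl, fun x => ?_⟩
  calc ∫⁻ ω, ‖Matrix.toEuclideanCLM (𝕜 := ℂ) (f ω x)‖ₑ ∂P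
      ≤ ∫⁻ ω, ∑ n, ∑ m, ‖f ω x n m‖ₑ ∂P := lintegral_mono fun ω => enorm_toEuclideanCLM_le _
    _ = ∑ n, ∑ m, ∫⁻ ω, ‖f ω x n m‖ₑ ∂P := by
        rw [lintegral_finsetSum' _ fun n _ =>
          Finset.aemeasurable_fun_sum _ fun m _ => (hf.measurable x n m).enorm]
        refine Finset.sum_congr rfl fun n _ => ?_
        rw [lintegral_finsetSum' _ fun m _ => (hf.measurable x n m).enorm]
    _ ≤ ∑ _n : Fin N, ∑ _m : Fin N, ENNReal.ofReal (A * Real.exp (-l * latNorm x)) := by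
        gcongr
        exact h x _ _
    _ = ENNReal.ofReal (N * N * (A * Real.exp (-l * latNorm x))) := by
        rw [ENNReal.ofReal_mul (p := (N : ℝ) * N) (by positivity),
          ENNReal.ofReal_mul (p := (N : ℝ)) (by positivity)]
        simp [mul_assoc]
    _ ≤ _ := by
        refine ENNReal.ofReal_le_ofReal ?_
        have : 0 ≤ A * Real.exp (-l * latNorm x) := by positivity
        nlinarith

theorem MemLInfty.exists_bound (hf : MemLInfty B P f) :
    ∃ c : ℝ, 0 < c ∧ ∀ᵐ ω ∂P, ∀ x n m, ‖f ω x n m‖ ≤ c := by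
  obtain ⟨C, hC⟩ := hf.bounded
  refine ⟨max C 1, by positivity, hC.mono fun ω ⟨T, hT, hTC⟩ x n m => ?_⟩
  exact (norm_obs_le hT x n m).trans (hTC.trans (le_max_left _ _))

theorem MemLInfty.add (hf : MemLInfty B P f) (hg : MemLInfty B P g) : MemLInfty B P (f + g) := by
  refine ⟨fun x n m => (hf.measurable x n m).add (hg.measurable x n m), ?_⟩
  obtain ⟨C, hC⟩ := hf.bounded
  obtain ⟨C', hC'⟩ := hg.bounded
  refine ⟨C + C', ?_⟩
  filter_upwards [hC, hC'] with ω ⟨T, hT, hTC⟩ ⟨S, hS, hSC⟩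
  exact ⟨T + S, hT.piKernel_add hS, (norm_add_le _ _).trans (add_le_add hTC hSC)⟩

theorem MemLInfty.smul (c : ℂ) (hf : MemLInfty B P f) : MemLInfty B P (c • f) := by
  refine ⟨fun x n m => (hf.measurable x n m).const_mul c, ?_⟩
  obtain ⟨C, hC⟩ := hf.bounded
  refine ⟨‖c‖ * C, ?_⟩
  filter_upwards [hC] with ω ⟨T, hT, hTC⟩
  exact ⟨c • T, hT.piKernel_smul c, by rw [norm_smul]; gcongr⟩

theorem MemLoc.add (hf : MemLoc B P f) (hg : MemLoc B P g) : MemLoc B P (f + g) := by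
  refine (hf.toMemLInfty.add hg.toMemLInfty).memLoc ?_
  obtain ⟨A, hA, l, hl, h, h'⟩ := hf.entryDecay.common hg.entryDecay
  refine ⟨2 * A, by positivity, l, hl, fun x n m => ?_⟩
  calc _ ≤ ∫⁻ ω, ‖f ω x n m‖ₑ + ‖g ω x n m‖ₑ ∂P := lintegral_mono fun ω => enorm_add_le _ _
    _ = ∫⁻ ω, ‖f ω x n m‖ₑ ∂P + ∫⁻ ω, ‖g ω x n m‖ₑ ∂P :=
        lintegral_add_left' (hf.measurable x n m).enorm _
    _ ≤ _ := add_le_add (h x n m) (h' x n m)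
    _ = _ := by
        rw [← two_mul, mul_assoc 2, ENNReal.ofReal_mul (p := 2) (by positivity)]
        simp

theorem MemLoc.smul (c : ℂ) (hf : MemLoc B P f) : MemLoc B P (c • f) := by
  refine (hf.toMemLInfty.smul c).memLoc ?_
  obtain ⟨A, hA, l, hl, h⟩ := hf.entryDecay
  refine ⟨(‖c‖ + 1) * A, by positivity, l, hl, fun x n m => ?_⟩
  calc _ = ∫⁻ ω, ‖c‖ₑ * ‖f ω x n m‖ₑ ∂P := by
        refine lintegral_congr fun ω => ?_
        rw [← enorm_mul]
        rfl
    _ = ‖c‖ₑ * ∫⁻ ω, ‖f ω x n m‖ₑ ∂P := lintegral_const_mul' _ _ (by simp)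
    _ ≤ ENNReal.ofReal (‖c‖ + 1) * ENNReal.ofReal (A * Real.exp (-l * latNorm x)) := by
        rw [← ofReal_norm]
        gcongr
        · linarith
        · exact h x n m
    _ = _ := by rw [← ENNReal.ofReal_mul (by positivity), mul_assoc]

variable [MeasurableConstVAdd (Lat d) Ω] [VAddInvariantMeasure (Lat d) Ω P]

/-- Invariance preserves null sets under each translation, and `ℤ^d` is countable. -/
theorem ae_forall_vadd {p : Ω → Prop} (h : ∀ᵐ ω ∂P, p ω) : ∀ᵐ ω ∂P, ∀ x : Lat d, p (x +ᵥ ω) :=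
  ae_all_iff.2 fun x => (measurePreserving_vadd x P).quasiMeasurePreserving.ae h

theorem lintegral_vadd (h : Ω → ℝ≥0∞) (x : Lat d) : ∫⁻ ω, h (x +ᵥ ω) ∂P = ∫⁻ ω, h ω ∂P :=
  (measurePreserving_vadd x P).lintegral_comp_emb (measurableEmbedding_const_vadd x) h

theorem AEMeasurable.vadd_obs {β : Type*} [MeasurableSpace β] {h : Ω → β} (hh : AEMeasurable h P)
    (x : Lat d) : AEMeasurable (fun ω => h (x +ᵥ ω)) P :=
  hh.comp_quasiMeasurePreserving (measurePreserving_vadd x P).quasiMeasurePreserving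

theorem MemLInfty.aemeasurable_piKernel (hf : MemLInfty B P f) (p q : Site d N) :
    AEMeasurable (fun ω => piKernel B ω f p q) P :=
  (AEMeasurable.vadd_obs (hf.measurable _ _ _) (-p.1)).const_mul _

theorem MemLInfty.invol (hf : MemLInfty B P f) : MemLInfty B P (invol f) := by
  refine ⟨fun x n m => ?_, ?_⟩
  · exact (continuous_star.measurable.comp_aemeasurable
      (AEMeasurable.vadd_obs (hf.measurable (-x) m n) (-x)))
  obtain ⟨C, hC⟩ := hf.bounded
  refine ⟨C, ?_⟩
  filter_upwards [hC] with ω ⟨T, hT, hTC⟩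
  exact ⟨_, hT.piKernel_invol, by rwa [LinearIsometryEquiv.norm_map]⟩

theorem MemLoc.invol (hf : MemLoc B P f) : MemLoc B P (invol f) := by
  refine hf.toMemLInfty.invol.memLoc ?_
  obtain ⟨A, hA, l, hl, h⟩ := hf.entryDecay
  refine ⟨A, hA, l, hl, fun x n m => ?_⟩
  calc _ = ∫⁻ ω, ‖f (-x +ᵥ ω) (-x) m n‖ₑ ∂P := by
        refine lintegral_congr fun ω => ?_
        rw [OddChern.invol, Matrix.conjTranspose_apply, ← ofReal_norm, norm_star, ofReal_norm]
    _ = ∫⁻ ω, ‖f ω (-x) m n‖ₑ ∂P := lintegral_vadd (fun ω => ‖f ω (-x) m n‖ₑ) (-x)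
    _ ≤ _ := by
        rw [← latNorm_neg x]
        exact h (-x) m n

theorem MemLInfty.conv (hf : MemLInfty B P f) (hg : MemLInfty B P g) :
    MemLInfty B P (conv B f g) := by
  obtain ⟨C, hC⟩ := hf.bounded
  obtain ⟨C', hC'⟩ := hg.bounded
  refine ⟨fun x n m => ?_, max C 0 * max C' 0, ?_⟩
  · simp only [conv_apply_eq_piKernel]
    refine aemeasurable_of_hasSum
      (fun r => (hf.aemeasurable_piKernel (0, n) r).mul (hg.aemeasurable_piKernel r (x, m))) ?_
    filter_upwards [hC, hC'] with ω ⟨T, hT, _⟩ ⟨S, hS, _⟩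
    exact hasSum_piKernel_conv hT hS _ _
  · filter_upwards [hC, hC'] with ω ⟨T, hT, hTC⟩ ⟨S, hS, hSC⟩
    refine ⟨T * S, hT.piKernel_conv hS, (norm_mul_le _ _).trans ?_⟩
    gcongr
    · exact hTC.trans (le_max_left _ _)
    · exact hSC.trans (le_max_left _ _)

/-- In each term of the convolution one of `|y|`, `|x-y|` is at least `|x|/2`. The factor with the
longer hop is averaged and gives exponential decay; the other is bounded almost surely by a
constant. -/
theorem MemLoc.conv (hf : MemLoc B P f) (hg : MemLoc B P g) : MemLoc B P (conv B f g) := by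
  refine (hf.toMemLInfty.conv hg.toMemLInfty).memLoc ?_
  obtain ⟨A, hA, l, hl, h, h'⟩ := hf.entryDecay.common hg.entryDecay
  obtain ⟨C, hC, hCf⟩ := hf.exists_bound
  obtain ⟨C', hC', hCg⟩ := hg.exists_bound
  obtain ⟨D, hDdef⟩ : ∃ D, D = max C C' := ⟨_, rfl⟩
  have hD : 0 < D := by rw [hDdef]; exact lt_max_of_lt_left hC
  let Z : ℝ≥0∞ := ∑' y : Lat d, ENNReal.ofReal (Real.exp (-(l / 2) * latNorm y))
  have hZ : Z ≠ ∞ := tsum_exp_latNorm_ne_top (by positivity)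
  refine ⟨N * Z.toReal * (D * A) + 1, by positivity, l / 4, by positivity, fun x n m => ?_⟩
  have hterm : ∀ (y : Lat d) (k : Fin N),
      ∫⁻ ω, ‖f ω y n k‖ₑ * ‖g (-y +ᵥ ω) (x - y) k m‖ₑ ∂P ≤
        ENNReal.ofReal (D * A * Real.exp (-(l / 4) * latNorm x)) *
          ENNReal.ofReal (Real.exp (-(l / 2) * latNorm y)) := by
    intro y k
    -- Half of `l|z|` is at least `l|x|/4`, the decay to be proved, and the other half is at least
    -- `l|y|/2`, which makes the sum over `y` converge.
    have hb : ∀ z : Lat d, latNorm x ≤ 2 * latNorm z → latNorm y ≤ latNorm z →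
        ENNReal.ofReal D * ENNReal.ofReal (A * Real.exp (-l * latNorm z)) ≤
        ENNReal.ofReal (D * A * Real.exp (-(l / 4) * latNorm x)) *
          ENNReal.ofReal (Real.exp (-(l / 2) * latNorm y)) := by
      intro z h1 h2
      rw [← ENNReal.ofReal_mul (by positivity), ← ENNReal.ofReal_mul (by positivity)]
      refine ENNReal.ofReal_le_ofReal ?_
      rw [mul_assoc (D * A), ← Real.exp_add, ← mul_assoc]
      gcongr
      nlinarith
    have htri : latNorm x ≤ latNorm (x - y) + latNorm y := by
      simpa using latNorm_add_le (x - y) y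
    rcases le_total (latNorm y) (latNorm (x - y)) with hxy | hxy
    · refine le_trans ?_ (hb (x - y) (by linarith) hxy)
      calc _ ≤ ∫⁻ ω, ENNReal.ofReal D * ‖g (-y +ᵥ ω) (x - y) k m‖ₑ ∂P := by
            refine lintegral_mono_ae (hCf.mono fun ω hω => ?_)
            gcongr
            rw [← ofReal_norm]
            exact ENNReal.ofReal_le_ofReal ((hω y n k).trans (by rw [hDdef]; exact le_max_left _ _))
        _ = ENNReal.ofReal D * ∫⁻ ω, ‖g ω (x - y) k m‖ₑ ∂P := by
            rw [lintegral_const_mul' _ _ (by simp),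
              lintegral_vadd (fun ω => ‖g ω (x - y) k m‖ₑ) (-y)]
        _ ≤ _ := by gcongr; exact h' _ _ _
    · refine le_trans ?_ (hb y (by linarith) le_rfl)
      calc _ ≤ ∫⁻ ω, ENNReal.ofReal D * ‖f ω y n k‖ₑ ∂P := by
            refine lintegral_mono_ae ((ae_forall_vadd (d := d) hCg).mono fun ω hω => ?_)
            rw [mul_comm]
            gcongr
            rw [← ofReal_norm]
            exact ENNReal.ofReal_le_ofReal
              ((hω (-y) (x - y) k m).trans (by rw [hDdef]; exact le_max_right _ _))
        _ = ENNReal.ofReal D * ∫⁻ ω, ‖f ω y n k‖ₑ ∂P := by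
            rw [lintegral_const_mul' _ _ (by simp)]
        _ ≤ _ := by gcongr; exact h _ _ _
  obtain ⟨K, hK⟩ := hf.bounded
  obtain ⟨K', hK'⟩ := hg.bounded
  calc ∫⁻ ω, ‖OddChern.conv B f g ω x n m‖ₑ ∂P
      ≤ ∫⁻ ω, ∑' r : Site d N, ‖f ω r.1 n r.2‖ₑ * ‖g (-r.1 +ᵥ ω) (x - r.1) r.2 m‖ₑ ∂P := by
        refine lintegral_mono_ae ?_
        filter_upwards [hK, hK'] with ω ⟨T, hT, _⟩ ⟨S, hS, _⟩
        rw [conv_apply_eq_piKernel, ← (hasSum_piKernel_conv hT hS _ _).tsum_eq]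
        refine enorm_tsum_le_tsum_enorm.trans (ENNReal.tsum_le_tsum fun r => ?_)
        simp [piKernel, ← ofReal_norm, norm_phase]
    _ = ∑' r : Site d N, ∫⁻ ω, ‖f ω r.1 n r.2‖ₑ * ‖g (-r.1 +ᵥ ω) (x - r.1) r.2 m‖ₑ ∂P :=
        lintegral_tsum fun r => (hf.measurable _ _ _).enorm.mul
          (AEMeasurable.vadd_obs (hg.measurable (x - r.1) r.2 m) (-r.1)).enorm
    _ ≤ ∑' r : Site d N, ENNReal.ofReal (D * A * Real.exp (-(l / 4) * latNorm x)) *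
          ENNReal.ofReal (Real.exp (-(l / 2) * latNorm r.1)) :=
        ENNReal.tsum_le_tsum fun r => hterm r.1 r.2
    _ = ENNReal.ofReal (D * A * Real.exp (-(l / 4) * latNorm x)) * (N * Z) := by
        rw [ENNReal.tsum_mul_left]
        have := tsum_shift_right (β := Fin N)
          (fun y : Lat d => ENNReal.ofReal (Real.exp (-(l / 2) * latNorm y))) 0
        simp only [sub_zero, Fintype.card_fin] at this
        rw [this]
    _ = ENNReal.ofReal (N * Z.toReal * (D * A) * Real.exp (-(l / 4) * latNorm x)) := by
        rw [← ENNReal.ofReal_toReal hZ, ← ENNReal.ofReal_natCast, ← ENNReal.ofReal_mul (by positivity),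
          ← ENNReal.ofReal_mul (by positivity), ENNReal.toReal_ofReal (by positivity)]
        congr 1
        ring
    _ ≤ _ := by
        refine ENNReal.ofReal_le_ofReal ?_
        gcongr
        linarith

theorem ObsEq.ae_forall (h : ObsEq P f g) : ∀ᵐ ω ∂P, ∀ x : Lat d, f (x +ᵥ ω) = g (x +ᵥ ω) := by
  have h1 : ∀ᵐ ω ∂P, f ω = g ω := (ae_all_iff.2 h).mono fun ω hω => funext hω
  exact ae_forall_vadd h1

theorem ObsEq.ae_piKernel_eq (h : ObsEq P f g) :
    ∀ᵐ ω ∂P, piKernel B ω f = piKernel B ω g := by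
  filter_upwards [h.ae_forall] with ω hω
  ext p q
  rw [piKernel, piKernel, hω]

theorem MemLoc.congr (hf : MemLoc B P f) (h : ObsEq P f g) : MemLoc B P g := by
  refine ⟨⟨fun x n m => (hf.measurable x n m).congr ((h x).mono fun ω hω => by simp [hω]), ?_⟩, ?_⟩
  · obtain ⟨C, hC⟩ := hf.bounded
    refine ⟨C, ?_⟩
    filter_upwards [hC, h.ae_piKernel_eq (B := B)] with ω hω heq
    rwa [← heq]
  · obtain ⟨A, hA, l, hl, h'⟩ := hf.decay
    refine ⟨A, hA, l, hl, fun x => le_trans (le_of_eq ?_) (h' x)⟩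
    exact lintegral_congr_ae ((h x).mono fun ω hω => by simp [hω])

theorem ObsEq.spinOp_eq (h : ObsEq P f g) : ∀ᵐ ω ∂P, spinOp B ω f = spinOp B ω g := by
  filter_upwards [h.ae_piKernel_eq (B := B)] with ω hω
  have : spinKernel B ω f = spinKernel B ω g := by
    ext p q
    rw [spinKernel, spinKernel, hω]
  rw [spinOp, spinOp, this]

end Localized

theorem CompactObs.memLoc {Ω : Type*} [TopologicalSpace Ω] [MeasurableSpace Ω] [BorelSpace Ω]
    {d N : ℕ} [AddAction (Lat d) Ω] {B : MagneticForm d} (P : Measure Ω) [IsProbabilityMeasure P]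
    (f : CompactObs Ω B N) : MemLoc B P f.val := by
  obtain ⟨C, hC⟩ := f.exists_hasKernel
  have hf : MemLInfty B P f.val :=
    ⟨fun x n m => ((f.continuous_val x).matrix_elem n m).measurable.aemeasurable,
      C, Filter.Eventually.of_forall hC⟩
  refine hf.memLoc ?_
  obtain ⟨c, hc, hfc⟩ := f.exists_bound
  obtain ⟨s, hs⟩ := f.exists_finset
  -- On the finite support `c = c e^{|x|} e^{-|x|}`, and the sum dominates every `e^{|x|}` that
  -- occurs.
  refine ⟨c * (∑ z ∈ s, Real.exp (latNorm z)) + 1, by positivity, 1, one_pos, fun x n m => ?_⟩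
  by_cases hx : x ∈ s
  · calc ∫⁻ ω, ‖f.val ω x n m‖ₑ ∂P ≤ ∫⁻ _, ENNReal.ofReal c ∂P := by
          refine lintegral_mono fun ω => ?_
          rw [← ofReal_norm]
          exact ENNReal.ofReal_le_ofReal (hfc ω x n m)
      _ = ENNReal.ofReal c := by simp
      _ ≤ _ := by
          refine ENNReal.ofReal_le_ofReal ?_
          have h1 : Real.exp (latNorm x) ≤ ∑ z ∈ s, Real.exp (latNorm z) :=
            Finset.single_le_sum (f := fun z => Real.exp (latNorm z))
              (fun _ _ => (Real.exp_pos _).le) hx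
          calc c = c * Real.exp (latNorm x) * Real.exp (-1 * latNorm x) := by
                rw [mul_assoc, ← Real.exp_add]; simp
            _ ≤ (c * (∑ z ∈ s, Real.exp (latNorm z)) + 1) * Real.exp (-1 * latNorm x) := by
                gcongr
                have := mul_le_mul_of_nonneg_left h1 hc
                linarith
  · simp [hs x hx]

/-! ### The weighted mass of an observable -/

section Mass

variable {Ω : Type*} {d N : ℕ}

/-- The weight `e^{dε|z|} (1+|z|)^{d+1}` of a hopping vector `z`. -/
def hopWeight (ε : ℝ) (z : Lat d) : ℝ≥0∞ :=
  ENNReal.ofReal (Real.exp (ε * latNorm z)) ^ d * ENNReal.ofReal (1 + latNorm z) ^ (d + 1)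

/-- The weight `(1+|x|)^{-(d+1)}` of a site `x`. -/
def siteWeight (x : Lat d) : ℝ≥0∞ := ENNReal.ofReal ((1 + latNorm x)⁻¹) ^ (d + 1)

/-- Translating the inner variable factorises the double sum into a sum over sites and a sum over
hops. -/
theorem tsum_siteWeight_mul_ne_top {h : Lat d → ℝ≥0∞} (hh : ∑' z, h z ≠ ∞) :
    ∑' (p : Site d N) (q : Site d N), siteWeight p.1 * h (q.1 - p.1) ≠ ∞ := by
  simp only [ENNReal.tsum_mul_left, tsum_shift_right h, ENNReal.tsum_mul_right]
  have h1 := tsum_shift_right (β := Fin N) (siteWeight (d := d)) 0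
  simp only [sub_zero] at h1
  rw [h1]
  exact ENNReal.mul_ne_top (ENNReal.mul_ne_top (by simp) tsum_one_add_latNorm_inv_pow_ne_top)
    (ENNReal.mul_ne_top (by simp) hh)

variable [AddAction (Lat d) Ω]

/-- The weighted sum of the `(d+1)`-th powers of the matrix entries of `π_ω(f)` that controls the
Schatten norm of the commutators with the Dirac phases. -/
def weightedMass (ε : ℝ) (f : Obs Ω d N) (ω : Ω) : ℝ≥0∞ :=
  ∑' (p : Site d N) (q : Site d N), siteWeight p.1 *
    (hopWeight ε (q.1 - p.1) * ‖f (-p.1 +ᵥ ω) (q.1 - p.1) p.2 q.2‖ₑ ^ (d + 1))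

theorem weightedMass_ne_top_of_finite_range {f : Obs Ω d N} {c : ℝ} {s : Finset (Lat d)}
    (hf : ∀ ω x n m, ‖f ω x n m‖ ≤ c) (hs : ∀ x, x ∉ s → ∀ ω, f ω x = 0) (ε : ℝ) (ω : Ω) :
    weightedMass ε f ω ≠ ∞ := by
  classical
  let h : Lat d → ℝ≥0∞ := fun z =>
    if z ∈ s then hopWeight ε z * ENNReal.ofReal c ^ (d + 1) else 0
  have hh : ∑' z, h z ≠ ∞ := by
    rw [tsum_eq_sum (s := s) fun z hz => if_neg hz]
    refine ENNReal.sum_ne_top.2 fun z hz => ?_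
    simp only [if_pos hz, hopWeight]
    exact ENNReal.mul_ne_top (ENNReal.mul_ne_top (by simp) (by simp)) (by simp)
  refine ne_top_of_le_ne_top (tsum_siteWeight_mul_ne_top (N := N) hh) ?_
  refine ENNReal.tsum_le_tsum fun p => ENNReal.tsum_le_tsum fun q => ?_
  gcongr
  simp only [h]
  split_ifs with hz
  · gcongr
    rw [← ofReal_norm]
    exact ENNReal.ofReal_le_ofReal (hf _ _ _ _)
  · simp [hs _ hz]

/-! ### Averaging the weighted mass -/

section Average

variable [MeasurableSpace Ω] {B : MagneticForm d} {P : Measure Ω} {f : Obs Ω d N}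
  [MeasurableConstVAdd (Lat d) Ω] [VAddInvariantMeasure (Lat d) Ω P]

theorem MemLInfty.aemeasurable_weightedMass (hf : MemLInfty B P f) (ε : ℝ) :
    AEMeasurable (weightedMass ε f) P := by
  refine AEMeasurable.tsum fun p => AEMeasurable.tsum fun q => ?_
  exact (((AEMeasurable.vadd_obs (hf.measurable _ _ _) (-p.1)).enorm.pow_const _).const_mul
    _).const_mul _

theorem MemLoc.exists_lintegral_weightedMass_ne_top (hf : MemLoc B P f) :
    ∃ ε > 0, ∫⁻ ω, weightedMass ε f ω ∂P ≠ ∞ := by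
  obtain ⟨A, hA, l, hl, hdecay⟩ := hf.entryDecay
  obtain ⟨c, hc, hbound⟩ := hf.exists_bound
  -- Then `ε d ≤ l/2`: the weight `e^{dε|z|}` uses at most half of the decay, and the rest absorbs
  -- the polynomial weight.
  refine ⟨l / (2 * (d + 1)), by positivity, ?_⟩
  set ε := l / (2 * (d + 1) : ℝ) with hε
  have hεd : ε * d ≤ l / 2 := by
    rw [hε, div_mul_eq_mul_div, div_le_div_iff₀ (by positivity) (by positivity)]
    nlinarith
  let h : Lat d → ℝ≥0∞ := fun z =>
    hopWeight ε z * (ENNReal.ofReal c ^ d * ENNReal.ofReal (A * Real.exp (-l * latNorm z)))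
  have hmeas : ∀ p q : Site d N, AEMeasurable
      (fun ω => ‖f (-p.1 +ᵥ ω) (q.1 - p.1) p.2 q.2‖ₑ ^ (d + 1)) P := fun p q =>
    (AEMeasurable.vadd_obs (hf.measurable _ _ _) (-p.1)).enorm.pow_const _
  -- Invariance removes the translation. Of the `d+1` powers, `d` are estimated by the almost sure
  -- bound `c` and the last is averaged.
  have hint : ∀ (x z : Lat d) (n m : Fin N), ∫⁻ ω, ‖f (-x +ᵥ ω) z n m‖ₑ ^ (d + 1) ∂P ≤
      ENNReal.ofReal c ^ d * ENNReal.ofReal (A * Real.exp (-l * latNorm z)) := by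
    intro x z n m
    rw [lintegral_vadd (fun ω => ‖f ω z n m‖ₑ ^ (d + 1)) (-x)]
    calc _ ≤ ∫⁻ ω, ENNReal.ofReal c ^ d * ‖f ω z n m‖ₑ ∂P := by
          refine lintegral_mono_ae (hbound.mono fun ω hω => ?_)
          rw [pow_succ]
          gcongr
          rw [← ofReal_norm]
          exact ENNReal.ofReal_le_ofReal (hω z n m)
      _ = ENNReal.ofReal c ^ d * ∫⁻ ω, ‖f ω z n m‖ₑ ∂P := lintegral_const_mul' _ _ (by simp)
      _ ≤ _ := by gcongr; exact hdecay z n m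
  have hh : ∑' z, h z ≠ ∞ := by
    refine ne_top_of_le_ne_top (ENNReal.mul_ne_top (ENNReal.ofReal_ne_top (r := c ^ d * A))
      (tsum_latNorm_pow_mul_exp_ne_top (d := d) (d + 1) (half_pos hl))) ?_
    rw [← ENNReal.tsum_mul_left]
    refine ENNReal.tsum_le_tsum fun z => ?_
    have hz := latNorm_nonneg z
    simp only [h, hopWeight]
    rw [← ENNReal.ofReal_pow (by positivity), ← ENNReal.ofReal_pow (by positivity),
      ← ENNReal.ofReal_pow (by positivity), ← ENNReal.ofReal_mul (by positivity),
      ← ENNReal.ofReal_mul (by positivity), ← ENNReal.ofReal_mul (by positivity),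
      ← ENNReal.ofReal_mul (by positivity)]
    refine ENNReal.ofReal_le_ofReal ?_
    rw [← Real.exp_nat_mul]
    calc _ = c ^ d * A * ((1 + latNorm z) ^ (d + 1) *
          Real.exp (d * (ε * latNorm z) + -l * latNorm z)) := by rw [Real.exp_add]; ring
      _ ≤ _ := by
          gcongr
          nlinarith
  refine ne_top_of_le_ne_top (tsum_siteWeight_mul_ne_top (N := N) hh) ?_
  unfold weightedMass
  rw [lintegral_tsum fun p => AEMeasurable.tsum fun q =>
    ((hmeas p q).const_mul _).const_mul _]
  refine ENNReal.tsum_le_tsum fun p => ?_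
  rw [lintegral_tsum fun q => ((hmeas p q).const_mul _).const_mul _]
  refine ENNReal.tsum_le_tsum fun q => ?_
  rw [lintegral_const_mul'' _ ((hmeas p q).const_mul _), lintegral_const_mul'' _ (hmeas p q)]
  simp only [h]
  gcongr
  exact hint _ _ _ _

end Average

end Mass

/-! ### Schatten bound for the commutators -/

section Commutator

variable {d : ℕ}

theorem tsum_tsum_spinSite {N : ℕ} (F : Site d N → Site d N → ℝ≥0∞) :
    ∑' (p : SpinSite d N) (q : SpinSite d N), F (p.1, p.2.1) (q.1, q.2.1) =
      spinDim d * (spinDim d * ∑' p, ∑' q, F p q) := by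
  simp only [tsum_spinSite, spinInsert, Finset.sum_const, Finset.card_univ, Fintype.card_fin,
    nsmul_eq_mul, ENNReal.tsum_mul_left]

/-- The constant in the Schatten bound for commutators with the Dirac phases. -/
def commutatorConst (d N : ℕ) (ε : ℝ) : ℝ≥0∞ :=
  (Fintype.card (Fin N × Fin (spinDim d)) *
      ∑' z : Lat d, ENNReal.ofReal (Real.exp (-ε * latNorm z))) ^ d *
    (spinDim d * (spinDim d * ENNReal.ofReal (8 * (d + 1)) ^ (d + 1)))

theorem commutatorConst_ne_top (d N : ℕ) {ε : ℝ} (hε : 0 < ε) : commutatorConst d N ε ≠ ∞ :=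
  ENNReal.mul_ne_top
    (ENNReal.pow_ne_top
      (ENNReal.mul_ne_top (ENNReal.natCast_ne_top _) (tsum_exp_latNorm_ne_top hε)))
    (ENNReal.mul_ne_top (ENNReal.natCast_ne_top _) (ENNReal.mul_ne_top (ENNReal.natCast_ne_top _)
      (ENNReal.pow_ne_top ENNReal.ofReal_ne_top)))

variable {Ω : Type*} {N : ℕ} [AddAction (Lat d) Ω] {B : MagneticForm d} {ω : Ω} {f : Obs Ω d N}
  {σ : Fin d → Matrix (Fin (spinDim d)) (Fin (spinDim d)) ℂ}

/-- The slow variation of the phase supplies the site weight and `1+|z|`; the kernel criterion with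
`W = e^{-ε|z|}` supplies `e^{dε|z|}`, because `2k-1 = d`. The bound is uniform over the cube of
shifts. -/
theorem commutator_compact_and_schattenTrace_le (hd : Odd d) (hσ : IsCliffordRep σ)
    {x₀ : Fin d → ℝ} (hx₀ : x₀ ∈ unitCube d)
    (hf : HasKernel (spinOp B ω f) (spinKernel B ω f)) {ε : ℝ} (hε : 0 < ε)
    (hmass : weightedMass ε f ω ≠ ∞) :
    IsCompactOperator (diracPhase σ x₀ N * spinOp B ω f - spinOp B ω f * diracPhase σ x₀ N) ∧
    schattenTrace (d + 1) (diracPhase σ x₀ N * spinOp B ω f - spinOp B ω f * diracPhase σ x₀ N) ≤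
      commutatorConst d N ε * weightedMass ε f ω := by
  obtain ⟨j, hj⟩ := hd
  obtain ⟨k, hk⟩ : ∃ k, d + 1 = 2 * k := ⟨j + 1, by omega⟩
  let w : Lat d → ℝ≥0∞ := fun z => ENNReal.ofReal (Real.exp (-ε * latNorm z))
  let K : SpinSite d N → SpinSite d N → ℂ := fun p q =>
    (phaseFiber σ x₀ p.1 p.2.2 q.2.2 - phaseFiber σ x₀ q.1 p.2.2 q.2.2) *
        piKernel B ω f (p.1, p.2.1) (q.1, q.2.1)
  have hw : ∀ z, (w z)⁻¹ = ENNReal.ofReal (Real.exp (ε * latNorm z)) := by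
    intro z
    rw [← ENNReal.ofReal_inv_of_pos (Real.exp_pos _), ← Real.exp_neg, neg_mul, neg_neg]
  have hterm : ∀ p q : SpinSite d N, (w (q.1 - p.1))⁻¹ ^ d * ‖K p q‖ₑ ^ (d + 1) ≤
      ENNReal.ofReal (8 * (d + 1)) ^ (d + 1) * (siteWeight p.1 * (hopWeight ε (q.1 - p.1) *
        ‖f (-p.1 +ᵥ ω) (q.1 - p.1) p.2.1 q.2.1‖ₑ ^ (d + 1))) := by
    intro p q
    have h0 := latNorm_nonneg (q.1 - p.1)
    have h1 := latNorm_nonneg p.1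
    have hK : ‖K p q‖ₑ ≤ ENNReal.ofReal (8 * (d + 1)) * (ENNReal.ofReal ((1 + latNorm p.1)⁻¹) *
        (ENNReal.ofReal (1 + latNorm (q.1 - p.1)) *
          ‖f (-p.1 +ᵥ ω) (q.1 - p.1) p.2.1 q.2.1‖ₑ)) := by
      rw [← ofReal_norm, ← ofReal_norm (f _ _ _ _), ← ENNReal.ofReal_mul (by positivity),
        ← ENNReal.ofReal_mul (by positivity), ← ENNReal.ofReal_mul (by positivity)]
      refine ENNReal.ofReal_le_ofReal ?_
      simp only [K, piKernel, norm_mul, norm_phase, one_mul]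
      refine (mul_le_mul_of_nonneg_right (norm_phaseFiber_sub_le hσ hx₀ p.1 q.1 _ _)
        (norm_nonneg _)).trans (le_of_eq ?_)
      rw [div_eq_mul_inv]
      ring
    rw [hw]
    refine (mul_le_mul_right (pow_le_pow_left₀ (by simp) hK (d + 1)) _).trans (le_of_eq ?_)
    simp only [mul_pow, siteWeight, hopWeight]
    ring
  have htotal : ∑' p, ∑' q, (w (q.1 - p.1))⁻¹ ^ (2 * k - 1) * ‖K p q‖ₑ ^ (2 * k) ≤
      (spinDim d * (spinDim d * ENNReal.ofReal (8 * (d + 1)) ^ (d + 1))) *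
        weightedMass ε f ω := by
    rw [← hk, Nat.add_sub_cancel]
    refine (ENNReal.tsum_le_tsum fun p => ENNReal.tsum_le_tsum fun q => hterm p q).trans
      (le_of_eq ?_)
    simp only [ENNReal.tsum_mul_left (a := ENNReal.ofReal (8 * (d + 1)) ^ (d + 1))]
    rw [tsum_tsum_spinSite (fun p q : Site d N => siteWeight p.1 * (hopWeight ε (q.1 - p.1) *
        ‖f (-p.1 +ᵥ ω) (q.1 - p.1) p.2 q.2‖ₑ ^ (d + 1))), weightedMass]
    ring
  have hC : Fintype.card (Fin N × Fin (spinDim d)) * ∑' z, w z ≠ ∞ :=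
    ENNReal.mul_ne_top (ENNReal.natCast_ne_top _) (tsum_exp_latNorm_ne_top hε)
  have main := compact_and_schattenTrace_le_of_kernel (hasKernel_commutator hσ x₀ hf)
    (W := fun p q => w (q.1 - p.1)) (fun p q => (ENNReal.ofReal_pos.2 (Real.exp_pos _)).ne')
    (fun p q => ENNReal.ofReal_ne_top) hC
    (fun p => (tsum_shift_right (β := Fin N × Fin (spinDim d)) w p.1).le)
    (fun q => (tsum_shift_left (β := Fin N × Fin (spinDim d)) w q.1).le) (k := k) (by omega)
    (ne_top_of_le_ne_top (ENNReal.mul_ne_top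
      (ENNReal.mul_ne_top (ENNReal.natCast_ne_top _) (ENNReal.mul_ne_top
        (ENNReal.natCast_ne_top _) (ENNReal.pow_ne_top ENNReal.ofReal_ne_top))) hmass) htotal)
  refine ⟨main.1, ?_⟩
  rw [hk]
  refine main.2.trans ?_
  have hpow : 2 * k - 1 = d := by omega
  rw [hpow] at htotal
  rw [commutatorConst, mul_assoc, hpow]
  exact mul_le_mul' le_rfl htotal

end Commutator

/-! ### Measurability of traces -/

section Measurability

variable {α ι : Type*} [MeasurableSpace α] [Countable ι] {μ : Measure α}

theorem aemeasurable_entry_mul {T S : α → (ℓ²(ι, ℂ) →L[ℂ] ℓ²(ι, ℂ))}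
    (hT : ∀ i j, AEMeasurable (fun a => entry (T a) i j) μ)
    (hS : ∀ i j, AEMeasurable (fun a => entry (S a) i j) μ) (i j : ι) :
    AEMeasurable (fun a => entry (T a * S a) i j) μ :=
  aemeasurable_of_hasSum (fun l => (hT i l).mul (hS l j))
    (Filter.Eventually.of_forall fun a => hasSum_entry_mul (T a) (S a) i j)

theorem aemeasurable_entry_pow {T : α → (ℓ²(ι, ℂ) →L[ℂ] ℓ²(ι, ℂ))}
    (hT : ∀ i j, AEMeasurable (fun a => entry (T a) i j) μ) (k : ℕ) (i j : ι) :
    AEMeasurable (fun a => entry (T a ^ k) i j) μ := by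
  induction k generalizing i j with
  | zero => simp only [pow_zero]; exact aemeasurable_const
  | succ k ih =>
    simp only [pow_succ]
    exact aemeasurable_entry_mul ih hT i j

/-- For an even exponent the trace is a countable sum of entries of `(T*T)^k`, and these are
iterated countable sums of products of entries of `T` and their conjugates. -/
theorem aemeasurable_schattenTrace {T : α → (ℓ²(ι, ℂ) →L[ℂ] ℓ²(ι, ℂ))}
    (hT : ∀ i j, AEMeasurable (fun a => entry (T a) i j) μ) (k : ℕ) :
    AEMeasurable (fun a => schattenTrace (2 * k) (T a)) μ := by
  simp only [schattenTrace_two_mul k _ (stdBasis ι), stdBasis_apply, ← entry_eq_inner]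
  refine AEMeasurable.tsum fun i => ENNReal.measurable_ofReal.comp_aemeasurable
    (Complex.measurable_re.comp_aemeasurable (aemeasurable_entry_pow (fun i j => ?_) k i i))
  refine aemeasurable_entry_mul (fun i j => ?_) hT i j
  simp only [ContinuousLinearMap.star_eq_adjoint, entry_adjoint]
  exact continuous_star.measurable.comp_aemeasurable (hT j i)

end Measurability

theorem MemLInfty.aemeasurable_schattenTrace_commutator {Ω : Type*} {d N : ℕ} [MeasurableSpace Ω]
    [AddAction (Lat d) Ω] [MeasurableConstVAdd (Lat d) Ω] {B : MagneticForm d} {P : Measure Ω}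
    [SFinite P] [VAddInvariantMeasure (Lat d) Ω P] {f : Obs Ω d N} (hf : MemLInfty B P f)
    (hd : Odd d) {σ : Fin d → Matrix (Fin (spinDim d)) (Fin (spinDim d)) ℂ}
    (hσ : IsCliffordRep σ) (ν : Measure (Fin d → ℝ)) [SFinite ν] :
    AEMeasurable (fun q : Ω × (Fin d → ℝ) => schattenTrace (d + 1)
      (diracPhase σ q.2 N * spinOp B q.1 f - spinOp B q.1 f * diracPhase σ q.2 N)) (P.prod ν) := by
  obtain ⟨j, hj⟩ := hd
  obtain ⟨k, hk⟩ : ∃ k, d + 1 = 2 * k := ⟨j + 1, by omega⟩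
  have h1 : ∀ p q : SpinSite d N,
      AEMeasurable (fun a : Ω × (Fin d → ℝ) => entry (spinOp B a.1 f) p q) (P.prod ν) := by
    intro p q
    refine AEMeasurable.comp_fst (f := fun ω => entry (spinOp B ω f) p q) ?_
    have hm : AEMeasurable (fun ω => spinKernel B ω f p q) P := by
      unfold spinKernel
      split_ifs
      · exact hf.aemeasurable_piKernel _ _
      · exact aemeasurable_const
    -- The entries agree with the kernel only where `π_ω(f)` is bounded, hence almost everywhere.
    refine hm.congr ?_
    obtain ⟨C, hC⟩ := hf.bounded
    filter_upwards [hC] with ω ⟨T, hT, _⟩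
    rw [← (hasKernel_spinOp hT).eq_entry]
  have h2 : ∀ p q : SpinSite d N,
      AEMeasurable (fun a : Ω × (Fin d → ℝ) => entry (diracPhase σ a.2 N) p q) (P.prod ν) := by
    intro p q
    refine Measurable.aemeasurable (Measurable.comp
      (g := fun x₀ : Fin d → ℝ => entry (diracPhase σ x₀ N) p q) ?_ measurable_snd)
    simp only [← (hasKernel_diracPhase N hσ _).eq_entry, phaseKernel]
    split_ifs
    · exact measurable_phaseFiber hσ _ _ _
    · exact measurable_const
  rw [hk]
  refine aemeasurable_schattenTrace (fun p q => ?_) k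
  simp only [entry_sub]
  exact (aemeasurable_entry_mul h2 h1 p q).sub (aemeasurable_entry_mul h1 h2 p q)

/-! ### The Fredholm modules -/

section Fredholm

variable {Ω : Type*} {d N : ℕ} [AddAction (Lat d) Ω] {B : MagneticForm d}
  {σ : Fin d → Matrix (Fin (spinDim d)) (Fin (spinDim d)) ℂ}

/-- Randomness enters only through two conditions at the given `ω`: boundedness of `π_ω(f)` and
finiteness of some weighted mass. Neither involves `x₀`. -/
theorem isSummableModuleOn (hd : Odd d) (hσ : IsCliffordRep σ) {x₀ : Fin d → ℝ}
    (hx₀ : x₀ ∈ unitCube d) {ω : Ω} {S : Set (Obs Ω d N)}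
    (hbdd : ∀ f ∈ S, ∃ T : ℓ²(Site d N, ℂ) →L[ℂ] ℓ²(Site d N, ℂ), HasKernel T (piKernel B ω f))
    (hmass : ∀ f ∈ S, ∃ ε > 0, weightedMass ε f ω ≠ ∞) :
    IsSummableModuleOn B σ (d + 1) ω x₀ S := by
  have hker : ∀ f ∈ S, HasKernel (spinOp B ω f) (spinKernel B ω f) := fun f hf =>
    (hbdd f hf).elim fun _ hT => hasKernel_spinOp hT
  refine
    { hasKernel := hker
      map_one := spinOp_unitObs
      map_add := fun f hf g hg => ?_
      map_smul := fun c f hf => ?_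
      map_mul := fun f hf g hg => ?_
      map_star := fun f hf => ?_
      hasKernel_phase := hasKernel_diracPhase N hσ x₀
      selfAdjoint := diracPhase_adjoint N hσ x₀
      involutive := diracPhase_mul_self N hσ x₀
      compact := fun f hf => ?_
      summable := fun f hf => ?_ }
  · obtain ⟨T, hT⟩ := hbdd f hf
    obtain ⟨R, hR⟩ := hbdd g hg
    exact spinOp_add hT hR
  · obtain ⟨T, hT⟩ := hbdd f hf
    exact spinOp_smul c hT
  · obtain ⟨T, hT⟩ := hbdd f hf
    obtain ⟨R, hR⟩ := hbdd g hg
    exact spinOp_conv hT hR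
  · obtain ⟨T, hT⟩ := hbdd f hf
    exact spinOp_invol hT
  · obtain ⟨ε, hε, hm⟩ := hmass f hf
    exact (commutator_compact_and_schattenTrace_le hd hσ hx₀ (hker f hf) hε hm).1
  · obtain ⟨ε, hε, hm⟩ := hmass f hf
    exact (commutator_compact_and_schattenTrace_le hd hσ hx₀ (hker f hf) hε hm).2.trans_lt
      (ENNReal.mul_ne_top (commutatorConst_ne_top d N hε) hm).lt_top

theorem CompactObs.isSummableModuleOn_range [TopologicalSpace Ω] (hd : Odd d)
    (hσ : IsCliffordRep σ) {x₀ : Fin d → ℝ} (hx₀ : x₀ ∈ unitCube d) (ω : Ω) :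
    IsSummableModuleOn B σ (d + 1) ω x₀ (Set.range (CompactObs.val : CompactObs Ω B N → _)) := by
  refine isSummableModuleOn hd hσ hx₀ ?_ ?_
  · rintro _ ⟨f, rfl⟩
    obtain ⟨C, hC⟩ := f.exists_hasKernel
    obtain ⟨T, hT, -⟩ := hC ω
    exact ⟨T, hT⟩
  · rintro _ ⟨f, rfl⟩
    obtain ⟨c, -, hfc⟩ := f.exists_bound
    obtain ⟨s, hs⟩ := f.exists_finset
    exact ⟨1, one_pos, weightedMass_ne_top_of_finite_range hfc hs 1 ω⟩

variable [TopologicalSpace Ω] [CompactSpace Ω] [ContinuousConstVAdd (Lat d) Ω]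

/-- The representation `π_ω ⊗ id` of the algebra of compactly supported observables. -/
def CompactObs.spinRep (B : MagneticForm d) (N : ℕ) (ω : Ω) :
    CompactObs Ω B N →⋆ₐ[ℂ] (SpinSpace d N →L[ℂ] SpinSpace d N) :=
  have hbdd (f : CompactObs Ω B N) :
      ∃ T : ℓ²(Site d N, ℂ) →L[ℂ] ℓ²(Site d N, ℂ), HasKernel T (piKernel B ω f.val) :=
    f.exists_hasKernel.elim fun _ h => (h ω).imp fun _ => And.left
  { toFun := fun f => spinOp B ω f.val
    map_one' := spinOp_unitObs
    map_mul' := fun f g => spinOp_conv (hbdd f).choose_spec (hbdd g).choose_spec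
    map_zero' := by
      have h := spinOp_smul 0 (hbdd 0).choose_spec
      simpa using h
    map_add' := fun f g => spinOp_add (hbdd f).choose_spec (hbdd g).choose_spec
    commutes' := fun c => by
      have h := spinOp_smul c (hbdd 1).choose_spec
      rw [val_one, spinOp_unitObs] at h
      rw [Algebra.algebraMap_eq_smul_one, Algebra.algebraMap_eq_smul_one]
      exact h
    map_star' := fun f => spinOp_invol (hbdd f).choose_spec }

end Fredholm

end OddChern

end

/-! ### Proof of the theorem -/

open scoped lp in
open OddChern MeasureTheory in
theorem mainTheorem5 {Ω : Type*} [TopologicalSpace Ω] [CompactSpace Ω] [T2Space Ω]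
    [MeasurableSpace Ω] [BorelSpace Ω] {d : ℕ} (hd : Odd d) (N : ℕ)
    [AddAction (Lat d) Ω] [ContinuousConstVAdd (Lat d) Ω]
    (P : Measure Ω) [IsProbabilityMeasure P] [ErgodicVAdd (Lat d) Ω P]
    (B : MagneticForm d)
    (σ : Fin d → Matrix (Fin (spinDim d)) (Fin (spinDim d)) ℂ) (hσ : IsCliffordRep σ) :
    -- a family of (d+1)-summable odd Fredholm modules over the algebra `𝒜₀`
    (∀ ω : Ω, ∀ x₀ ∈ unitCube d, ∃ M : OddFredholmModule (CompactObs Ω B N) (SpinSpace d N),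
      M.F = diracPhase σ x₀ N ∧ HasKernel M.F (phaseKernel σ x₀ N) ∧
      (∀ f, M.π f = spinOp B ω f.val ∧ HasKernel (M.π f) (spinKernel B ω f.val)) ∧
      M.IsSummable (d + 1)) ∧
    -- `𝒜_loc` is a *-algebra (up to almost sure equality) that contains `𝒜₀`
    ((∀ f : CompactObs Ω B N, MemLoc B P f.val) ∧
      (∀ f g : Obs Ω d N, MemLoc B P f → MemLoc B P g →
        MemLoc B P (f + g) ∧ MemLoc B P (conv B f g) ∧ MemLoc B P (invol f) ∧
          ∀ c : ℂ, MemLoc B P (c • f)) ∧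
      (∀ f g : Obs Ω d N, MemLoc B P f → ObsEq P f g →
        MemLoc B P g ∧ ∀ᵐ ω ∂P, spinOp B ω f = spinOp B ω g)) ∧
    -- the Fredholm modules extend almost surely to `𝒜_loc`
    (∀ S : Set (Obs Ω d N), S.Countable → (∀ f ∈ S, MemLoc B P f) →
      ∀ᵐ ω ∂P, ∀ x₀ ∈ unitCube d, IsSummableModuleOn B σ (d + 1) ω x₀ S) ∧
    -- the averaged bound
    (∀ f : Obs Ω d N, MemLoc B P f →
      AEMeasurable (fun q : Ω × (Fin d → ℝ) => schattenTrace (d + 1)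
          (diracPhase σ q.2 N * spinOp B q.1 f - spinOp B q.1 f * diracPhase σ q.2 N))
        (P.prod (volume.restrict (unitCube d))) ∧
      ∫⁻ ω, (∫⁻ x₀ in unitCube d, schattenTrace (d + 1)
          (diracPhase σ x₀ N * spinOp B ω f - spinOp B ω f * diracPhase σ x₀ N) ∂volume) ∂P < ⊤) := by
  refine ⟨fun ω x₀ hx₀ => ?_, ⟨CompactObs.memLoc P, fun f g hf hg => ?_, fun f g hf hfg => ?_⟩,
    fun S hS hloc => ?_, fun f hf => ⟨?_, ?_⟩⟩
  · have h := CompactObs.isSummableModuleOn_range (B := B) (N := N) hd hσ hx₀ ω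
    exact ⟨{ π := CompactObs.spinRep B N ω
             F := diracPhase σ x₀ N
             selfAdjoint := h.selfAdjoint
             involutive := h.involutive
             compact := fun f => h.compact f.val ⟨f, rfl⟩ },
      rfl, h.hasKernel_phase, fun f => ⟨rfl, h.hasKernel f.val ⟨f, rfl⟩⟩,
      fun f => h.summable f.val ⟨f, rfl⟩⟩
  · exact ⟨hf.add hg, hf.conv hg, hf.invol, fun c => hf.smul c⟩
  · exact ⟨hf.congr hfg, hfg.spinOp_eq⟩
  -- Countability of `S` gives one null set for all observables. It is chosen before `x₀`, so it
  -- serves every shift.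
  · have hae : ∀ᵐ ω ∂P, ∀ f ∈ S,
        (∃ T : ℓ²(Site d N, ℂ) →L[ℂ] ℓ²(Site d N, ℂ), HasKernel T (piKernel B ω f)) ∧
          ∃ ε > 0, weightedMass ε f ω ≠ ⊤ := by
      refine (ae_ball_iff hS).2 fun f hf => ?_
      obtain ⟨C, hC⟩ := (hloc f hf).bounded
      obtain ⟨ε, hε, hint⟩ := (hloc f hf).exists_lintegral_weightedMass_ne_top
      filter_upwards [hC, ae_lt_top' ((hloc f hf).aemeasurable_weightedMass ε) hint]
        with ω ⟨T, hT, _⟩ hω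
      exact ⟨⟨T, hT⟩, ε, hε, hω.ne⟩
    filter_upwards [hae] with ω hω x₀ hx₀
    exact isSummableModuleOn hd hσ hx₀ (fun f hf => (hω f hf).1) fun f hf => (hω f hf).2
  · exact hf.aemeasurable_schattenTrace_commutator hd hσ _
  · obtain ⟨C, hC⟩ := hf.bounded
    obtain ⟨ε, hε, hint⟩ := hf.exists_lintegral_weightedMass_ne_top
    have hvol : volume (unitCube d) ≠ ⊤ := (isCompact_Icc (a := (0 : Fin d → ℝ))).measure_ne_top
    have hconst := commutatorConst_ne_top d N hε
    -- The commutator bound is constant in `x₀`, so integration over the cube only multiplies it by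
    -- the finite volume.
    refine lt_of_le_of_lt (lintegral_mono_ae (g := fun ω =>
      commutatorConst d N ε * weightedMass ε f ω * volume (unitCube d)) ?_) ?_
    · filter_upwards [hC, ae_lt_top' (hf.aemeasurable_weightedMass ε) hint] with ω ⟨T, hT, _⟩ hω
      rw [← setLIntegral_const]
      exact setLIntegral_mono' measurableSet_Icc fun x₀ hx₀ =>
        (commutator_compact_and_schattenTrace_le hd hσ hx₀ (hasKernel_spinOp hT) hε hω.ne).2
    · rw [lintegral_mul_const' _ _ hvol, lintegral_const_mul' _ _ hconst]
      exact (ENNReal.mul_ne_top (ENNReal.mul_ne_top hconst hint) hvol).lt_top
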